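/- Let $X=[0,1]/(0\sim 1)$ be the circle with its arc length metric $d$, let $T:X\to X$, $T(x)=4x \pmod 1$, let $U:X\to X$ be the bijection $$U(x)=\begin{cases}3x/2,&0\le x<1/8,\\ x+1/16,&1/8\le x<3/8,\\ x/2+1/4,&3/8\le x<1/2,\\ x,&1/2\le x\le 1,\end{cases}$$ and let $S=U^{-1}\circ T\circ U$. **(1)** The semigroup $\mathcal S$ generated by $T$ and $S$ under composition is free on $\{T,S\}$: two elements of $\mathcal S$ coincide if and only if they have the same representation as a product of the generators. **(2)** Let $\mathbb G$ be the semigroup generated by $(T,0)$ and $(S,0)$ under the product $(g_1,\psi_1)\ast(g_2,\psi_2)=(g_1\circ g_2,\ \psi_2+\psi_1\circ g_2)$ of pairs consisting of a map $X\to X$ and a potential $X\to\mathbb R$ (so that all potentials that occur are $0$). For every $(g,\psi)\in\mathbb G$ there is exactly one equilibrium state $\mu_{g,\psi}$, that is, exactly one $g$-invariant Borel probability measure on $X$ that maximises $H_\nu(g)+\int\psi\,d\nu$ among all $g$-invariant Borel probability measures $\nu$, where $H_\nu(g)$ is the Kolmogorov entropy. As $\psi=0$, this is the measure of maximal entropy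 of $g$. **(3)** Let $\alpha\in(0,1]$ and $\Delta>0$, let $\overline W(\mu,\nu)$ be the infimum of $\int d^*\,dP$ over all couplings $P$ of $\mu$ and $\nu$, where $d^*(x,y)=\min\{1,\Delta\, d(x,y)^\alpha\}$, and let $$\kappa(g)=\lim_{\varepsilon\to0}\inf\Big\{\tfrac{d(g(x),g(y))}{d(x,y)}:0<d(x,y)<\varepsilon\Big\}.$$ Then $$d_{\mathbb G}\big((g,\psi_1),(h,\psi_2)\big)=\begin{cases}\overline W(\mu_{g,\psi_1},\mu_{h,\psi_2})+\frac1{\kappa(g)}+\frac1{\kappa(h)},&(g,\psi_1)\ne(h,\psi_2),\\ 0,&(g,\psi_1)=(h,\psi_2),\end{cases}$$ is a metric on $\mathbb G$, and the boundary $\partial\mathbb G$, i.e. the complement of $\mathbb G$ in its completion with respect to $d_{\mathbb G}$, is homeomorphic to the space $\Sigma^-=\{\ldots i_2i_1: i_1,i_2,\ldots\in\{0,1\}\}$ of left-infinite words on two letters with the product topology. More precisely, with $g_0=T$ and $g_1=S$, the map $$\ldots i_2i_1\ \mapsto\ \lim_{n\to\infty}\,(g_{i_n},0)\ast\cdots\ast(g_{i_2},0)\ast(g_{i_1},0)$$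 is well defined and is a homeomorphism from $\Sigma^-$ onto $\partial\mathbb G$. -/

import Mathlib

open Set Filter Topology MeasureTheory
open scoped ENNReal

noncomputable section

namespace EquilibriumBoundary

/-! ### The two circle maps -/

/-- The space `X = [0,1]` with the endpoints identified, with its arc length metric. -/
abbrev X : Type := UnitAddCircle

/-- The map `x ↦ 4x mod 1`. -/
def T : X → X := fun x => (4 : ℕ) • x

/-- The piecewise linear formula for `U` on `[0,1]`. -/
def uFormula (x : ℝ) : ℝ :=
  if x < 1 / 8 then 3 * x / 2
  else if x < 3 / 8 then x + 1 / 16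
  else if x < 1 / 2 then x / 2 + 1 / 4
  else x

/-- The piecewise linear formula for the inverse of `U` on `[0,1]`. -/
def uInvFormula (y : ℝ) : ℝ :=
  if y < 3 / 16 then 2 * y / 3
  else if y < 7 / 16 then y - 1 / 16
  else if y < 1 / 2 then 2 * y - 1 / 2
  else y

/-- `U` as a bijection of `[0,1)`. -/
def uIco : Ico (0 : ℝ) (0 + 1) ≃ Ico (0 : ℝ) (0 + 1) where
  toFun x := ⟨uFormula x, by
    obtain ⟨x, h0, h1⟩ := x
    simp only [uFormula]
    split_ifs <;> constructor <;> linarith⟩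
  invFun y := ⟨uInvFormula y, by
    obtain ⟨y, h0, h1⟩ := y
    simp only [uInvFormula]
    split_ifs <;> constructor <;> linarith⟩
  left_inv := by
    rintro ⟨x, h0, h1⟩
    apply Subtype.ext
    simp only [uFormula, uInvFormula]
    split_ifs <;> linarith
  right_inv := by
    rintro ⟨y, h0, h1⟩
    apply Subtype.ext
    simp only [uFormula, uInvFormula]
    split_ifs <;> linarith

/-- `U` as a bijection of the circle: a point is represented by its coordinate in `[0,1)`. -/
def U : X ≃ X :=
  ((AddCircle.equivIco (1 : ℝ) 0).trans uIco).trans (AddCircle.equivIco (1 : ℝ) 0).symm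

/-- The conjugate `S = U⁻¹ T U`. -/
def S : X → X := U.symm ∘ T ∘ U

/-- The generators, indexed by the alphabet `{0, 1}`: letter `0` is `T`, letter `1` is `S`. -/
def gen : Fin 2 → Function.End X := ![T, S]

/-- The semigroup of self-maps of `X` generated by `T` and `S`, under composition. -/
def mapSemigroup : Subsemigroup (Function.End X) := Subsemigroup.closure {T, S}

/-! ### Kolmogorov entropy and equilibrium states -/

section Entropy

variable {Y : Type*} [MeasurableSpace Y]

/-- Shannon entropy of the finite partition of `Y` into the level sets of `ξ`. -/
def partitionEntropy {ι : Type*} [Fintype ι] (μ : Measure Y) (ξ : Y → ι) : ℝ :=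
  ∑ i, Real.negMulLog (μ.real (ξ ⁻¹' {i}))

/-- The join of the partitions `ξ, g⁻¹ξ, …, g⁻⁽ⁿ⁻¹⁾ξ`. -/
def joinPartition {ι : Type*} (g : Y → Y) (ξ : Y → ι) (n : ℕ) : Y → (Fin n → ι) :=
  fun y j => ξ (g^[j] y)

/-- Kolmogorov entropy of `g` with respect to `μ`: the supremum over finite measurable partitions
`ξ` of the limit of `H(ξ ∨ g⁻¹ξ ∨ ⋯ ∨ g⁻⁽ⁿ⁻¹⁾ξ) / n`. For an invariant probability measure the
limit exists by subadditivity, so that it is the limit superior. -/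
def kolmogorovEntropy (μ : Measure Y) (g : Y → Y) : EReal :=
  ⨆ (k : ℕ) (ξ : Y → Fin k) (_ : Measurable ξ),
    limsup (fun n : ℕ => ((partitionEntropy μ (joinPartition g ξ n) / n : ℝ) : EReal)) atTop

/-- `μ` is an equilibrium state of `(g, ψ)`: it is `g`-invariant and maximises
`H_ν(g) + ∫ ψ dν` among all `g`-invariant Borel probability measures `ν`. -/
def IsEquilibriumState (g : Y → Y) (ψ : Y → ℝ) (μ : ProbabilityMeasure Y) : Prop :=
  MeasurePreserving g (μ : Measure Y) (μ : Measure Y) ∧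
    ∀ ν : ProbabilityMeasure Y, MeasurePreserving g (ν : Measure Y) (ν : Measure Y) →
      kolmogorovEntropy (ν : Measure Y) g + ((∫ y, ψ y ∂(ν : Measure Y) : ℝ) : EReal) ≤
        kolmogorovEntropy (μ : Measure Y) g + ((∫ y, ψ y ∂(μ : Measure Y) : ℝ) : EReal)

end Entropy

/-! ### The semigroup of maps with potentials -/

/-- A self-map together with a potential. -/
@[ext]
structure WeightedMap (Y : Type*) where
  /-- the map -/
  map : Y → Y
  /-- the potential -/
  potential : Y → ℝ

/-- The product `(g₁, ψ₁) ∗ (g₂, ψ₂) = (g₁ ∘ g₂, ψ₂ + ψ₁ ∘ g₂)`. -/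
instance (Y : Type*) : Semigroup (WeightedMap Y) where
  mul p q := ⟨p.map ∘ q.map, q.potential + p.potential ∘ q.map⟩
  mul_assoc p q r := by
    apply WeightedMap.ext
    · rfl
    · funext y
      exact (add_assoc (r.potential y) (q.potential (r.map y))
        (p.potential (q.map (r.map y)))).symm

/-- The generators `(T, 0)` and `(S, 0)`. -/
def weightedGen (i : Fin 2) : WeightedMap X := ⟨gen i, 0⟩

/-- The semigroup `𝔾` generated by `(T, 0)` and `(S, 0)`. -/
def G : Subsemigroup (WeightedMap X) := Subsemigroup.closure (range weightedGen)

/-- The generators as elements of `𝔾`. -/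
def genG (i : Fin 2) : G :=
  ⟨weightedGen i, Subsemigroup.subset_closure (mem_range_self i)⟩

/-- The equilibrium state of an element of `𝔾` (meaningful once it exists and is unique). -/
def equilibriumState (p : G) : ProbabilityMeasure X :=
  Classical.epsilon (IsEquilibriumState p.1.map p.1.potential)

/-! ### The metric on `𝔾` -/

/-- The truncated Hölder distance `d*(x, y) = min {1, Δ d(x, y)^α}`. -/
def dStar {Y : Type*} [PseudoMetricSpace Y] (Δ α : ℝ) (x y : Y) : ℝ :=
  min 1 (Δ * dist x y ^ α)

/-- The Vaserstein distance with respect to `d*`: the infimum of `∫ d* dP` over the couplings `P`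
of `μ` and `ν`. -/
def vaserstein {Y : Type*} [PseudoMetricSpace Y] [MeasurableSpace Y] (Δ α : ℝ)
    (μ ν : ProbabilityMeasure Y) : ℝ :=
  sInf {r : ℝ | ∃ P : ProbabilityMeasure (Y × Y),
    (P : Measure (Y × Y)).map Prod.fst = (μ : Measure Y) ∧
    (P : Measure (Y × Y)).map Prod.snd = (ν : Measure Y) ∧
    r = ∫ z, dStar Δ α z.1 z.2 ∂(P : Measure (Y × Y))}

/-- The infimum of `d(g x, g y) / d(x, y)` over `0 < d(x, y) < ε`. -/
def expansionAtScale {Y : Type*} [PseudoMetricSpace Y] (g : Y → Y) (ε : ℝ) : ℝ≥0∞ :=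
  ⨅ (x : Y) (y : Y) (_ : 0 < dist x y) (_ : dist x y < ε), edist (g x) (g y) / edist x y

/-- The minimal local expansion `κ(g)`, the limit of `expansionAtScale g ε` as `ε → 0`; the limit
is the supremum, see `tendsto_expansionAtScale`. -/
def kappa {Y : Type*} [PseudoMetricSpace Y] (g : Y → Y) : ℝ≥0∞ :=
  ⨆ (ε : ℝ) (_ : 0 < ε), expansionAtScale g ε

theorem tendsto_expansionAtScale {Y : Type*} [PseudoMetricSpace Y] (g : Y → Y) :
    Tendsto (expansionAtScale g) (𝓝[>] 0) (𝓝 (kappa g)) := by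
  have hanti : Antitone (expansionAtScale g) := by
    intro a b hab
    refine le_iInf fun x => le_iInf fun y => le_iInf fun h => le_iInf fun h' => ?_
    exact iInf_le_of_le x (iInf_le_of_le y (iInf_le_of_le h (iInf_le _ (h'.trans_le hab))))
  have h := hanti.tendsto_nhdsGT 0
  rwa [sSup_image] at h

open Classical in
/-- The distance on `𝔾`. -/
def distG (Δ α : ℝ) (p q : G) : ℝ :=
  if p = q then 0
  else vaserstein Δ α (equilibriumState p) (equilibriumState q)
    + (1 / kappa p.1.map).toReal + (1 / kappa q.1.map).toReal

/-- The boundary of a metric space: the points that its completion adds to it. -/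
abbrev Boundary (M : Type*) [MetricSpace M] : Type _ :=
  {x : UniformSpace.Completion M // x ∉ range ((↑) : M → UniformSpace.Completion M)}

/-! ### Left-infinite words -/

/-- The space `Σ⁻` of left-infinite words `… i₂ i₁` over `{0, 1}` with the product topology; the
letter `i_{n+1}` of `σ` is `σ n`. -/
abbrev LeftWord : Type := ℕ → Fin 2

/-- For `σ = … i₂ i₁`, the product of the generators with indices `i_{n+1}, …, i₂, i₁`, in this
order; its map is `g_{i_{n+1}} ∘ ⋯ ∘ g_{i₂} ∘ g_{i₁}`. -/
def truncation (σ : LeftWord) : ℕ → G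
  | 0 => genG (σ 0)
  | n + 1 => genG (σ (n + 1)) * truncation σ n

end EquilibriumBoundary

end

open EquilibriumBoundary

/-! A product of `n` generators lifts to an increasing `F : ℝ → ℝ` with `F 0 = 0` and `F (x + k) = F
x + 4 ^ n * k` for integers `k`. The lift of `U` has slopes in `[1/2, 3/2]`, so each generator
expands by at least `(2/3) * 4 * (1/2) = 4/3`, and `F` by at least `(4/3) ^ n`.

Equilibrium states. For a word `σ` let `F_n` be the lift of the product of its first `n` letters.
The limit `h_σ = lim F_n / 4 ^ n` exists, is a homeomorphism of degree one, and satisfies `h_{σ'} ∘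
g = 4 h_σ`, where `g` is the generator of the first letter and `σ'` is `σ` without it. If `σ` has
period `n`, then `h_σ` conjugates the product of its first `n` letters to multiplication by `N = 4 ^
n`. For the latter the base `N` digits generate and Lebesgue measure gives every atom of the `k`-th
join mass `N ^ (-k)`; any other invariant measure has a join of entropy below `k log N`, hence
smaller entropy (`isEquilibriumState_iff_of_generating`). So the equilibrium state is the image of
Lebesgue measure under the inverse of `h_σ`.

Boundary. Words with the same first `n` letters have inverse conjugacies within `2 (3/4) ^ n` of
each other (`abs_conjIso_symm_sub_le`), so this measure depends continuously on `σ`. It determines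
`σ`, because its distribution function is `h_σ`, and `h_σ` takes the value `1/4` at `1/4` or at
`3/16` according to the first letter (`conj_injective`). The terms `1/κ` make every element of `𝔾`
isolated, yet decay like `(3/4) ^ n` along truncations (`invKappa_truncation_le`). Truncations
therefore converge to points outside `𝔾`; conversely, along a sequence approaching a boundary point
`1/κ` tends to zero, and compactness of the word space supplies a limiting word.

Freeness. The degree of a lift gives the length of the word; the point where the lift takes the
value `4 ^ (n - 1)` gives the letter applied first, which can be cancelled (`listLift_injective`).
-/

namespace EquilibriumBoundary

/-! ### Finite Shannon entropy -/

section Shannon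

set_option linter.unusedSectionVars false

/-- Each summand is at most the total, so minus its logarithm is at least minus the logarithm of the
total. -/
theorem negMulLog_sum_le {ι : Type*} (s : Finset ι) (p : ι → ℝ) (hp : ∀ i, 0 ≤ p i) :
    Real.negMulLog (∑ i ∈ s, p i) ≤ ∑ i ∈ s, Real.negMulLog (p i) := by
  simp only [Real.negMulLog]
  rw [neg_mul, Finset.sum_mul, ← Finset.sum_neg_distrib]
  refine Finset.sum_le_sum fun i hi => ?_
  rw [neg_mul, neg_le_neg_iff]
  rcases (hp i).eq_or_lt with h | h
  · simp [← h]
  · exact mul_le_mul_of_nonneg_left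
      (Real.log_le_log h (Finset.single_le_sum (fun j _ => hp j) hi)) h.le

/-- This is `log t ≤ t - 1` at `t = a b / (q Q)`, multiplied by `q`. For a joint distribution `q`
with marginals `a`, `b` and total mass `Q`, the left sides sum to zero. -/
theorem negMulLog_pair_le {q a b Q : ℝ} (hq : 0 ≤ q) (hqa : q ≤ a) (hqb : q ≤ b) (haQ : a ≤ Q) :
    q - a * b / Q ≤ q * (Real.log q + Real.log Q - Real.log a - Real.log b) := by
  rcases hq.eq_or_lt with h | h
  · subst h
    have : 0 ≤ a * b / Q := div_nonneg (mul_nonneg hqa hqb) (hqa.trans haQ)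
    linarith
  · have ha : 0 < a := h.trans_le hqa
    have hb : 0 < b := h.trans_le hqb
    have hQ : 0 < Q := ha.trans_le haQ
    have key := Real.log_le_sub_one_of_pos (x := a * b / (q * Q)) (by positivity)
    rw [Real.log_div (by positivity) (by positivity), Real.log_mul ha.ne' hb.ne',
      Real.log_mul h.ne' hQ.ne'] at key
    have := mul_le_mul_of_nonneg_left key h.le
    have e : q * (a * b / (q * Q) - 1) = a * b / Q - q := by field_simp
    linarith

/-- The entropy of a joint distribution is at most the sum of the entropies of the marginals,
in a form that is homogeneous in the total mass. -/
theorem sum_negMulLog_add_le {ι κ : Type*} [Fintype ι] [Fintype κ] (q : ι → κ → ℝ)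
    (hq : ∀ i j, 0 ≤ q i j) :
    ∑ i, ∑ j, Real.negMulLog (q i j) + Real.negMulLog (∑ i, ∑ j, q i j) ≤
      ∑ i, Real.negMulLog (∑ j, q i j) + ∑ j, Real.negMulLog (∑ i, q i j) := by
  set a : ι → ℝ := fun i => ∑ j, q i j with ha
  set b : κ → ℝ := fun j => ∑ i, q i j with hb
  set Q : ℝ := ∑ i, a i with hQ
  have hQb : Q = ∑ j, b j := Finset.sum_comm
  have ha0 : ∀ i, 0 ≤ a i := fun i => Finset.sum_nonneg fun j _ => hq i j
  have h1 : ∀ i j, q i j - a i * b j / Q ≤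
      q i j * (Real.log (q i j) + Real.log Q - Real.log (a i) - Real.log (b j)) := fun i j =>
    negMulLog_pair_le (hq i j)
      (Finset.single_le_sum (f := fun j => q i j) (fun j _ => hq i j) (Finset.mem_univ j))
      (Finset.single_le_sum (f := fun i => q i j) (fun i _ => hq i j) (Finset.mem_univ i))
      (Finset.single_le_sum (f := a) (fun i _ => ha0 i) (Finset.mem_univ i))
  have h2 : ∑ i, ∑ j, (q i j - a i * b j / Q) = 0 := by
    simp only [Finset.sum_sub_distrib]
    have : ∑ i, ∑ j, a i * b j / Q = Q * Q / Q := by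
      simp only [← Finset.sum_div, ← Finset.mul_sum, ← hQb, ← Finset.sum_mul]
      rfl
    -- Total mass zero needs no separate case, since `Q * Q / Q = Q` also for `Q = 0`.
    rw [this, mul_self_div_self, sub_self]
  have h3 := Finset.sum_le_sum fun i (_ : i ∈ Finset.univ) =>
    Finset.sum_le_sum fun j (_ : j ∈ Finset.univ) => h1 i j
  rw [h2] at h3
  have e1 : ∀ i, ∑ j, q i j * Real.log (a i) = a i * Real.log (a i) := fun i => by
    rw [← Finset.sum_mul]
  have e2 : ∑ i, ∑ j, q i j * Real.log (b j) = ∑ j, b j * Real.log (b j) := by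
    rw [Finset.sum_comm]
    exact Finset.sum_congr rfl fun j _ => by rw [← Finset.sum_mul]
  have e3 : ∑ i, ∑ j, q i j * Real.log Q = Q * Real.log Q := by
    simp only [← Finset.sum_mul]; rfl
  have e4 : ∑ i, ∑ j, q i j * (Real.log (q i j) + Real.log Q - Real.log (a i) - Real.log (b j)) =
      ∑ i, ∑ j, q i j * Real.log (q i j) + Q * Real.log Q - ∑ i, a i * Real.log (a i)
        - ∑ j, b j * Real.log (b j) := by
    simp only [mul_add, mul_sub, Finset.sum_add_distrib, Finset.sum_sub_distrib, e1, e2, e3]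
  simp only [Real.negMulLog, neg_mul, Finset.sum_neg_distrib]
  linarith

/-- The concave function `negMulLog` lies below its tangent at `1 / M`. Summed over `M` cells of
total mass one, the tangent gives `log M`; strictness away from `1 / M` is what later yields
uniqueness. -/
theorem negMulLog_le_of_pos {p : ℝ} {M : ℝ} (hp : 0 ≤ p) (hM : 0 < M) :
    Real.negMulLog p ≤ p * Real.log M + 1 / M - p := by
  rcases hp.eq_or_lt with h | h
  · subst h; simp [hM.le]
  · have key := Real.log_le_sub_one_of_pos (x := 1 / (M * p)) (by positivity)
    rw [one_div, Real.log_inv, Real.log_mul hM.ne' h.ne'] at key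
    have := mul_le_mul_of_nonneg_left key h.le
    have e : p * ((M * p)⁻¹ - 1) = 1 / M - p := by field_simp
    rw [Real.negMulLog]
    linarith

theorem negMulLog_lt_of_ne {p : ℝ} {M : ℝ} (hp : 0 ≤ p) (hM : 0 < M) (hne : p ≠ 1 / M) :
    Real.negMulLog p < p * Real.log M + 1 / M - p := by
  rcases hp.eq_or_lt with h | h
  · subst h; simp [hM]
  · have key := Real.log_lt_sub_one_of_pos (x := 1 / (M * p)) (by positivity) (by
      intro h1
      apply hne
      field_simp at h1 ⊢
      linarith)
    rw [one_div, Real.log_inv, Real.log_mul hM.ne' h.ne'] at key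
    have := mul_lt_mul_of_pos_left key h
    have e : p * ((M * p)⁻¹ - 1) = 1 / M - p := by field_simp
    rw [Real.negMulLog]
    linarith

variable {Y : Type*} [MeasurableSpace Y] {ι κ τ : Type*}
  [Fintype ι] [MeasurableSpace ι] [MeasurableSingletonClass ι]
  [Fintype κ] [MeasurableSpace κ] [MeasurableSingletonClass κ]
  [Fintype τ] [MeasurableSpace τ] [MeasurableSingletonClass τ]
  (μ : Measure Y) [IsProbabilityMeasure μ]

theorem measureReal_preimage_comp {ξ : Y → ι} (hξ : Measurable ξ) (f : ι → κ) (k : κ)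
    [DecidableEq κ] :
    μ.real ((f ∘ ξ) ⁻¹' {k}) = ∑ i with f i = k, μ.real (ξ ⁻¹' {i}) := by
  rw [← measureReal_biUnion_finset]
  · congr 1
    ext y
    simp
  · intro i _ j _ hij
    exact Disjoint.preimage _ (by simpa using hij)
  · intro i _
    exact hξ (measurableSet_singleton i)

theorem sum_measureReal_preimage {ξ : Y → ι} (hξ : Measurable ξ) :
    ∑ i, μ.real (ξ ⁻¹' {i}) = 1 := by
  rw [← measureReal_biUnion_finset]
  · have : ⋃ i ∈ Finset.univ, ξ ⁻¹' {i} = univ := by ext y; simp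
    rw [this, probReal_univ]
  · intro i _ j _ hij
    exact Disjoint.preimage _ (by simpa using hij)
  · intro i _
    exact hξ (measurableSet_singleton i)

theorem partitionEntropy_nonneg (ξ : Y → ι) : 0 ≤ partitionEntropy μ ξ :=
  Finset.sum_nonneg fun _ _ => Real.negMulLog_nonneg measureReal_nonneg measureReal_le_one

/-- A coarser partition merges cells, and `negMulLog` is subadditive. Refinement is expressed by
`Function.FactorsThrough`, which for joins is a mere comparison of itineraries. -/
theorem partitionEntropy_mono {ξ : Y → ι} {η : Y → κ} (hξ : Measurable ξ)
    (h : η.FactorsThrough ξ) : partitionEntropy μ η ≤ partitionEntropy μ ξ := by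
  classical
  have : Nonempty Y := nonempty_of_isProbabilityMeasure μ
  have : Nonempty κ := this.map η
  obtain ⟨f, rfl⟩ := (Function.factorsThrough_iff η).1 h
  unfold partitionEntropy
  simp only [measureReal_preimage_comp μ hξ f]
  calc _ ≤ ∑ k, ∑ i with f i = k, Real.negMulLog (μ.real (ξ ⁻¹' {i})) :=
        Finset.sum_le_sum fun k _ => negMulLog_sum_le _ _ fun i => measureReal_nonneg
    _ = _ := Finset.sum_fiberwise _ f _

theorem partitionEntropy_eq {ξ : Y → ι} {η : Y → κ} (hξ : Measurable ξ) (hη : Measurable η)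
    (h : η.FactorsThrough ξ) (h' : ξ.FactorsThrough η) :
    partitionEntropy μ η = partitionEntropy μ ξ :=
  le_antisymm (partitionEntropy_mono μ hξ h) (partitionEntropy_mono μ hη h')

theorem sum_measureReal_pair_right {ξ : Y → ι} {η : Y → κ} (hξ : Measurable ξ)
    (hη : Measurable η) (i : ι) :
    ∑ j, μ.real ((fun y => (ξ y, η y)) ⁻¹' {(i, j)}) = μ.real (ξ ⁻¹' {i}) := by
  classical
  have := measureReal_preimage_comp μ (hξ.prodMk hη) Prod.fst i
  rw [show Prod.fst ∘ (fun y => (ξ y, η y)) = ξ from rfl] at this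
  rw [this]
  refine Finset.sum_bij (fun j _ => (i, j)) (by simp) (by simp) ?_ (by simp)
  rintro ⟨a, b⟩ hab
  simp at hab
  exact ⟨b, by simp, by simp [hab]⟩

theorem sum_measureReal_pair_left {ξ : Y → ι} {η : Y → κ} (hξ : Measurable ξ)
    (hη : Measurable η) (j : κ) :
    ∑ i, μ.real ((fun y => (ξ y, η y)) ⁻¹' {(i, j)}) = μ.real (η ⁻¹' {j}) := by
  rw [← sum_measureReal_pair_right μ hη hξ]
  refine Finset.sum_congr rfl fun i _ => ?_
  congr 1
  ext y
  simp [and_comm]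

theorem partitionEntropy_pair_le {ξ : Y → ι} {η : Y → κ} (hξ : Measurable ξ)
    (hη : Measurable η) :
    partitionEntropy μ (fun y => (ξ y, η y)) ≤ partitionEntropy μ ξ + partitionEntropy μ η := by
  have := sum_negMulLog_add_le (fun i j => μ.real ((fun y => (ξ y, η y)) ⁻¹' {(i, j)}))
    fun i j => measureReal_nonneg
  simp only [sum_measureReal_pair_right μ hξ hη, sum_measureReal_pair_left μ hξ hη,
    sum_measureReal_preimage μ hξ, Real.negMulLog_one, add_zero] at this
  rw [partitionEntropy, Fintype.sum_prod_type]
  exact this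

/-- Submodularity of Shannon entropy. -/
theorem partitionEntropy_submodular {ξ : Y → ι} {η : Y → κ} {ζ : Y → τ} (hξ : Measurable ξ)
    (hη : Measurable η) (hζ : Measurable ζ) :
    partitionEntropy μ (fun y => (ξ y, η y, ζ y)) + partitionEntropy μ ζ ≤
      partitionEntropy μ (fun y => (ξ y, ζ y)) + partitionEntropy μ (fun y => (η y, ζ y)) := by
  -- The inequality for joint distributions is used on each fibre of `ζ`; the mass of a fibre is not
  -- one, whence the homogeneous form.
  have key := fun k : τ => sum_negMulLog_add_le
    (fun i j => μ.real ((fun y => (ξ y, η y, ζ y)) ⁻¹' {(i, j, k)})) fun i j => measureReal_nonneg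
  have e1 : ∀ j k, ∑ i, μ.real ((fun y => (ξ y, η y, ζ y)) ⁻¹' {(i, j, k)}) =
      μ.real ((fun y => (η y, ζ y)) ⁻¹' {(j, k)}) := fun j k =>
    sum_measureReal_pair_left μ hξ (hη.prodMk hζ) (j, k)
  have e2 : ∀ i k, ∑ j, μ.real ((fun y => (ξ y, η y, ζ y)) ⁻¹' {(i, j, k)}) =
      μ.real ((fun y => (ξ y, ζ y)) ⁻¹' {(i, k)}) := fun i k => by
    rw [← sum_measureReal_pair_left μ hη (hξ.prodMk hζ)]
    refine Finset.sum_congr rfl fun j _ => ?_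
    congr 1
    ext y
    simp only [mem_preimage, mem_singleton_iff, Prod.mk.injEq]
    tauto
  simp only [e1, e2, sum_measureReal_pair_left μ hξ hζ] at key
  have := Finset.sum_le_sum fun k (_ : k ∈ Finset.univ) => key k
  simp only [Finset.sum_add_distrib] at this
  have f1 : partitionEntropy μ (fun y => (ξ y, η y, ζ y)) =
      ∑ k, ∑ i, ∑ j, Real.negMulLog (μ.real ((fun y => (ξ y, η y, ζ y)) ⁻¹' {(i, j, k)})) := by
    rw [partitionEntropy, Fintype.sum_prod_type, Finset.sum_comm]
    refine Eq.trans ?_ (Finset.sum_congr rfl fun k _ => Finset.sum_comm)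
    rw [Fintype.sum_prod_type, Finset.sum_comm]
  have f2 : partitionEntropy μ (fun y => (ξ y, ζ y)) =
      ∑ k, ∑ i, Real.negMulLog (μ.real ((fun y => (ξ y, ζ y)) ⁻¹' {(i, k)})) := by
    rw [partitionEntropy, Fintype.sum_prod_type, Finset.sum_comm]
  have f3 : partitionEntropy μ (fun y => (η y, ζ y)) =
      ∑ k, ∑ i, Real.negMulLog (μ.real ((fun y => (η y, ζ y)) ⁻¹' {(i, k)})) := by
    rw [partitionEntropy, Fintype.sum_prod_type, Finset.sum_comm]
  rw [f1, f2, f3, partitionEntropy]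
  exact this

theorem partitionEntropy_le_log_card {ξ : Y → ι} (hξ : Measurable ξ) :
    partitionEntropy μ ξ ≤ Real.log (Fintype.card ι) := by
  have : Nonempty Y := nonempty_of_isProbabilityMeasure μ
  have : Nonempty ι := this.map ξ
  have hM : (0 : ℝ) < Fintype.card ι := by exact_mod_cast Fintype.card_pos
  have := Finset.sum_le_sum fun i (_ : i ∈ Finset.univ) =>
    negMulLog_le_of_pos (measureReal_nonneg (μ := μ) (s := ξ ⁻¹' {i})) hM
  rw [Finset.sum_sub_distrib, Finset.sum_add_distrib, ← Finset.sum_mul,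
    sum_measureReal_preimage μ hξ] at this
  simpa [partitionEntropy, hM.ne'] using this

theorem partitionEntropy_lt_log_card {ξ : Y → ι} (hξ : Measurable ξ) {i : ι}
    (hi : μ.real (ξ ⁻¹' {i}) ≠ 1 / Fintype.card ι) :
    partitionEntropy μ ξ < Real.log (Fintype.card ι) := by
  have : Nonempty ι := ⟨i⟩
  have hM : (0 : ℝ) < Fintype.card ι := by exact_mod_cast Fintype.card_pos
  have := Finset.sum_lt_sum (s := Finset.univ)
    (fun i _ => negMulLog_le_of_pos (measureReal_nonneg (μ := μ) (s := ξ ⁻¹' {i})) hM)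
    ⟨i, Finset.mem_univ i, negMulLog_lt_of_ne measureReal_nonneg hM hi⟩
  rw [Finset.sum_sub_distrib, Finset.sum_add_distrib, ← Finset.sum_mul,
    sum_measureReal_preimage μ hξ] at this
  simpa [partitionEntropy, hM.ne'] using this

theorem partitionEntropy_comp_measurePreserving {g : Y → Y} (hg : MeasurePreserving g μ μ)
    {ξ : Y → ι} (hξ : Measurable ξ) : partitionEntropy μ (ξ ∘ g) = partitionEntropy μ ξ := by
  refine Finset.sum_congr rfl fun i _ => ?_
  rw [preimage_comp, hg.measureReal_preimage (hξ (measurableSet_singleton i)).nullMeasurableSet]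

end Shannon

/-! ### Entropy of a map with a generating partition -/

section Dynamics

set_option linter.unusedSectionVars false

variable {Y : Type*} [MeasurableSpace Y] {ι κ : Type*}
  [Fintype ι] [MeasurableSpace ι] [MeasurableSingletonClass ι]
  [Fintype κ] [MeasurableSpace κ] [MeasurableSingletonClass κ]
  {μ : Measure Y} [IsProbabilityMeasure μ] {g : Y → Y}

theorem measurable_joinPartition (hg : Measurable g) {ξ : Y → ι} (hξ : Measurable ξ) (n : ℕ) :
    Measurable (joinPartition g ξ n) :=
  measurable_pi_lambda _ fun j => hξ.comp (hg.iterate j)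

theorem joinPartition_eq_iff {ξ : Y → ι} {n : ℕ} {x y : Y} :
    joinPartition g ξ n x = joinPartition g ξ n y ↔ ∀ j < n, ξ (g^[j] x) = ξ (g^[j] y) :=
  ⟨fun h j hj => congrFun h ⟨j, hj⟩, fun h => funext fun j => h j j.2⟩

theorem partitionEntropy_joinPartition_mono (hg : Measurable g) {ξ : Y → ι} (hξ : Measurable ξ)
    {m n : ℕ} (hmn : m ≤ n) :
    partitionEntropy μ (joinPartition g ξ m) ≤ partitionEntropy μ (joinPartition g ξ n) :=
  partitionEntropy_mono μ (measurable_joinPartition hg hξ n) fun _ _ h =>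
    joinPartition_eq_iff.2 fun j hj => joinPartition_eq_iff.1 h j (hj.trans_le hmn)

theorem partitionEntropy_joinPartition_add_le (hg : MeasurePreserving g μ μ) {ξ : Y → ι}
    (hξ : Measurable ξ) (m n : ℕ) :
    partitionEntropy μ (joinPartition g ξ (m + n)) ≤
      partitionEntropy μ (joinPartition g ξ m) + partitionEntropy μ (joinPartition g ξ n) := by
  have hm := measurable_joinPartition hg.measurable hξ m
  have hn := (measurable_joinPartition hg.measurable hξ n).comp (hg.measurable.iterate m)
  rw [← partitionEntropy_comp_measurePreserving μ (hg.iterate m)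
    (measurable_joinPartition hg.measurable hξ n)]
  refine le_trans (partitionEntropy_mono μ (hm.prodMk hn) fun x y h => ?_)
    (partitionEntropy_pair_le μ hm hn)
  obtain ⟨h1, h2⟩ := Prod.ext_iff.1 h
  refine joinPartition_eq_iff.2 fun j hj => ?_
  rcases lt_or_ge j m with hjm | hjm
  · exact joinPartition_eq_iff.1 h1 j hjm
  · have := joinPartition_eq_iff.1 h2 (j - m) (by omega)
    rwa [← Function.iterate_add_apply, ← Function.iterate_add_apply, Nat.sub_add_cancel hjm] at this

theorem partitionEntropy_joinPartition_mul_le (hg : MeasurePreserving g μ μ) {ξ : Y → ι}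
    (hξ : Measurable ξ) (m q : ℕ) :
    partitionEntropy μ (joinPartition g ξ (q * m)) ≤
      q * partitionEntropy μ (joinPartition g ξ m) := by
  induction q with
  | zero =>
    refine (partitionEntropy_le_log_card μ
      (measurable_joinPartition hg.measurable hξ _)).trans ?_
    simp
  | succ q ih =>
    rw [Nat.succ_mul]
    refine (partitionEntropy_joinPartition_add_le hg hξ _ _).trans ?_
    push_cast
    linarith

/-- Cover `n` steps by `n / m + 1` blocks of length `m`. Division by `n` bounds the entropy rate by
the average over any single block length, without a limit theorem for subadditive sequences. -/
theorem partitionEntropy_joinPartition_le (hg : MeasurePreserving g μ μ) {ξ : Y → ι}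
    (hξ : Measurable ξ) {m : ℕ} (hm : 0 < m) (n : ℕ) :
    partitionEntropy μ (joinPartition g ξ n) ≤
      (n / m + 1) * partitionEntropy μ (joinPartition g ξ m) := by
  have h1 : n ≤ (n / m + 1) * m := by
    rw [mul_comm]; exact (Nat.lt_mul_div_succ n hm).le
  refine (partitionEntropy_joinPartition_mono hg.measurable hξ h1).trans
    ((partitionEntropy_joinPartition_mul_le hg hξ m _).trans ?_)
  refine mul_le_mul_of_nonneg_right ?_ (partitionEntropy_nonneg μ _)
  push_cast
  gcongr
  exact Nat.cast_div_le

/-- Replacing a partition by another one costs at most the conditional entropy per step. -/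
theorem partitionEntropy_joinPartition_pair_sub_le (hg : MeasurePreserving g μ μ) {ξ : Y → ι}
    {η : Y → κ} (hξ : Measurable ξ) (hη : Measurable η) (n : ℕ) :
    partitionEntropy μ (fun y => (joinPartition g ξ n y, joinPartition g η n y)) -
        partitionEntropy μ (joinPartition g η n) ≤
      n * (partitionEntropy μ (fun y => (ξ y, η y)) - partitionEntropy μ η) := by
  induction n with
  | zero =>
    rw [partitionEntropy_eq μ (measurable_joinPartition hg.measurable hη 0)
      ((measurable_joinPartition hg.measurable hξ 0).prodMk
        (measurable_joinPartition hg.measurable hη 0))]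
    · simp
    · intro x y _
      simp [joinPartition_eq_iff]
    · intro x y _
      simp [joinPartition_eq_iff]
  | succ n ih =>
    have hA := measurable_joinPartition hg.measurable hξ n
    have hA' := measurable_joinPartition hg.measurable hη n
    have hB := hξ.comp (hg.measurable.iterate n)
    have hB' := hη.comp (hg.measurable.iterate n)
    -- With `A`, `A'` the two `n`-joins and `B`, `B'` the partitions at time `n`, these say `H(A |
    -- A', B') ≤ H(A | A')` and `H(B | A, A', B') ≤ H(B | B')`. By the chain rule the conditional
    -- entropy grows by at most `H(B | B')`, which equals `H(ξ | η)` by invariance.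
    have s1 := partitionEntropy_submodular μ hA hB' hA'
    have s2 := partitionEntropy_submodular μ hB (hA.prodMk hA') hB'
    have e1 := partitionEntropy_comp_measurePreserving μ (hg.iterate n) (hξ.prodMk hη)
    have e2 := partitionEntropy_comp_measurePreserving μ (hg.iterate n) hη
    have hsplit : ∀ {x y : Y}, (joinPartition g ξ (n + 1) x = joinPartition g ξ (n + 1) y ↔
        joinPartition g ξ n x = joinPartition g ξ n y ∧ ξ (g^[n] x) = ξ (g^[n] y)) := by
      intro x y
      simp only [joinPartition_eq_iff, Nat.lt_succ_iff_lt_or_eq]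
      constructor
      · exact fun h => ⟨fun j hj => h j (Or.inl hj), h n (Or.inr rfl)⟩
      · rintro ⟨h1, h2⟩ j (hj | rfl)
        exacts [h1 j hj, h2]
    have hsplit' : ∀ {x y : Y}, (joinPartition g η (n + 1) x = joinPartition g η (n + 1) y ↔
        joinPartition g η n x = joinPartition g η n y ∧ η (g^[n] x) = η (g^[n] y)) := by
      intro x y
      simp only [joinPartition_eq_iff, Nat.lt_succ_iff_lt_or_eq]
      constructor
      · exact fun h => ⟨fun j hj => h j (Or.inl hj), h n (Or.inr rfl)⟩
      · rintro ⟨h1, h2⟩ j (hj | rfl)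
        exacts [h1 j hj, h2]
    have e3 : partitionEntropy μ
        (fun y => (joinPartition g ξ (n + 1) y, joinPartition g η (n + 1) y)) ≤
        partitionEntropy μ (fun y => ((ξ ∘ g^[n]) y,
          (joinPartition g ξ n y, joinPartition g η n y), (η ∘ g^[n]) y)) := by
      refine partitionEntropy_mono μ (hB.prodMk ((hA.prodMk hA').prodMk hB')) fun x y h => ?_
      simp only [Prod.mk.injEq, hsplit, hsplit', Function.comp_apply] at h ⊢
      tauto
    have e4 : partitionEntropy μ (fun y => ((η ∘ g^[n]) y, joinPartition g η n y)) ≤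
        partitionEntropy μ (joinPartition g η (n + 1)) := by
      refine partitionEntropy_mono μ (measurable_joinPartition hg.measurable hη _)
        fun x y h => ?_
      simp only [Prod.mk.injEq, hsplit', Function.comp_apply] at h ⊢
      tauto
    have e5 : partitionEntropy μ (fun y => ((joinPartition g ξ n y, joinPartition g η n y),
        (η ∘ g^[n]) y)) ≤ partitionEntropy μ (fun y => (joinPartition g ξ n y,
          (η ∘ g^[n]) y, joinPartition g η n y)) := by
      refine partitionEntropy_mono μ (hA.prodMk (hB'.prodMk hA')) fun x y h => ?_
      simp only [Prod.mk.injEq] at h ⊢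
      tauto
    have e6 : (fun y => ((ξ ∘ g^[n]) y, (η ∘ g^[n]) y)) = (fun y => (ξ y, η y)) ∘ g^[n] := rfl
    rw [e6] at s2
    push_cast
    linarith

/-- Every finite measurable partition of a compact metric space is approximated by partitions
that are coarser than the joins of a generating partition. -/
theorem exists_factorsThrough_approx {Y : Type*} [MetricSpace Y] [CompactSpace Y]
    [MeasurableSpace Y] [BorelSpace Y] {μ : Measure Y} [IsProbabilityMeasure μ] {g : Y → Y}
    {α : Y → ι} (hgen : ∀ δ > 0, ∃ r, ∀ x y,
      joinPartition g α r x = joinPartition g α r y → dist x y < δ)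
    {ξ : Y → κ} (hξ : Measurable ξ) {ε : ℝ} (hε : 0 < ε) :
    ∃ r, ∃ η : Y → κ, η.FactorsThrough (joinPartition g α r) ∧ μ.real {y | ξ y ≠ η y} < ε := by
  classical
  have : Nonempty Y := nonempty_of_isProbabilityMeasure μ
  have : Nonempty κ := this.map ξ
  have hcard : (0 : ℝ) < Fintype.card κ := by exact_mod_cast Fintype.card_pos
  have hK : ∀ i, ∃ K ⊆ ξ ⁻¹' {i}, IsClosed K ∧
      μ (ξ ⁻¹' {i} \ K) < ENNReal.ofReal (ε / Fintype.card κ) := fun i =>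
    (hξ (measurableSet_singleton i)).exists_isClosed_sdiff_lt (measure_ne_top _ _)
      (by simpa using div_pos hε hcard)
  choose K hKs hKc hKμ using hK
  -- Disjoint compact sets have positive distance, and there are finitely many pairs.
  have hδ : ∀ᶠ δ : ℝ in 𝓝[>] 0, ∀ i j, i ≠ j → ∀ x ∈ K i, ∀ y ∈ K j, δ ≤ dist x y := by
    rw [eventually_all]; intro i
    rw [eventually_all]; intro j
    by_cases hij : i = j
    · exact Eventually.of_forall fun δ h => absurd hij h
    obtain ⟨r, hr, h⟩ := Metric.exists_pos_forall_lt_edist (hKc i).isCompact (hKc j)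
      (Disjoint.mono (hKs i) (hKs j) (Disjoint.preimage _ (by simpa using hij)))
    filter_upwards [Ioo_mem_nhdsGT (show (0 : ℝ) < r from hr)] with δ hδ _ x hx y hy
    have := h x hx y hy
    rw [edist_nndist, ENNReal.coe_lt_coe] at this
    exact hδ.2.le.trans (show (r : ℝ) < dist x y by exact_mod_cast this).le
  obtain ⟨δ, hδ, hδ0⟩ := (hδ.and self_mem_nhdsWithin).exists
  obtain ⟨r, hr⟩ := hgen δ hδ0
  -- Points of one atom are less than `δ` apart, so an atom meets at most one of the sets `K i`; it
  -- receives that label. Errors then occur only outside the union of these sets.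
  let f : (Fin r → ι) → κ := fun a =>
    if h : ∃ i, ∃ x ∈ K i, joinPartition g α r x = a then h.choose else Classical.arbitrary κ
  refine ⟨r, f ∘ joinPartition g α r, fun x y h => congrArg f h, ?_⟩
  have hsub : {y | ξ y ≠ (f ∘ joinPartition g α r) y} ⊆
      ⋃ i ∈ (Finset.univ : Finset κ), ξ ⁻¹' {i} \ K i := by
    intro y hy
    simp only [Finset.mem_univ, iUnion_true, mem_iUnion]
    refine ⟨ξ y, rfl, fun hyK => hy ?_⟩
    have hex : ∃ i, ∃ x ∈ K i, joinPartition g α r x = joinPartition g α r y :=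
      ⟨ξ y, y, hyK, rfl⟩
    simp only [Function.comp_apply, f, dif_pos hex]
    obtain ⟨x, hx, hxy⟩ := hex.choose_spec
    by_contra hne
    exact absurd (hr x y hxy) (not_lt.2 (hδ _ _ (Ne.symm hne) x hx y hyK))
  calc μ.real {y | ξ y ≠ (f ∘ joinPartition g α r) y} ≤ _ :=
        measureReal_mono hsub (measure_ne_top _ _)
    _ ≤ ∑ i, μ.real (ξ ⁻¹' {i} \ K i) := measureReal_biUnion_finset_le _ _
    _ < ∑ _i : κ, ε / Fintype.card κ := by
      refine Finset.sum_lt_sum_of_nonempty Finset.univ_nonempty fun i _ => ?_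
      exact (ENNReal.lt_ofReal_iff_toReal_lt (measure_ne_top _ _)).1 (hKμ i)
    _ = ε := by simp; field_simp

theorem abs_measureReal_sub_le_of_subset {A B D : Set Y} (hA : MeasurableSet A)
    (hB : MeasurableSet B) (h1 : A \ B ⊆ D) (h2 : B \ A ⊆ D) :
    |μ.real A - μ.real B| ≤ μ.real D :=
  (abs_measureReal_sub_le_measureReal_symmDiff hA.nullMeasurableSet hB.nullMeasurableSet).trans
    (measureReal_mono (union_subset h1 h2))

/-- The conditional entropy of `ξ` given a partition close to `ξ` is small. -/
theorem exists_conditionalEntropy_lt (μ : Measure Y) [IsProbabilityMeasure μ] {ξ : Y → κ}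
    (hξ : Measurable ξ) {ε : ℝ} (hε : 0 < ε) :
    ∃ δ > 0, ∀ η : Y → κ, Measurable η → μ.real {y | ξ y ≠ η y} < δ →
      partitionEntropy μ (fun y => (ξ y, η y)) - partitionEntropy μ η < ε := by
  -- Otherwise there are `η n` that differ from `ξ` on sets of measure tending to zero. All cell
  -- masses converge, and continuity of `negMulLog` sends the conditional entropies to `H(ξ, ξ) -
  -- H(ξ) = 0`.
  by_contra! hcon
  have hpos : ∀ n : ℕ, (0 : ℝ) < 1 / (n + 1) := fun n => by positivity
  choose η hη hclose hbig using fun n : ℕ => hcon (1 / (n + 1)) (hpos n)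
  have hlim : Tendsto (fun n : ℕ => μ.real {y | ξ y ≠ η n y}) atTop (𝓝 0) :=
    squeeze_zero (fun _ => measureReal_nonneg) (fun n => (hclose n).le)
      tendsto_one_div_add_atTop_nhds_zero_nat
  have htend : ∀ (A : ℕ → Set Y) (B : Set Y), (∀ n, MeasurableSet (A n)) → MeasurableSet B →
      (∀ n, A n \ B ⊆ {y | ξ y ≠ η n y}) → (∀ n, B \ A n ⊆ {y | ξ y ≠ η n y}) →
      Tendsto (fun n => Real.negMulLog (μ.real (A n))) atTop (𝓝 (Real.negMulLog (μ.real B))) := by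
    intro A B hA hB h1 h2
    refine (Real.continuous_negMulLog.tendsto _).comp ?_
    rw [tendsto_iff_dist_tendsto_zero]
    exact squeeze_zero (fun _ => dist_nonneg)
      (fun n => abs_measureReal_sub_le_of_subset (hA n) hB (h1 n) (h2 n)) hlim
  have t1 : Tendsto (fun n => partitionEntropy μ (fun y => (ξ y, η n y))) atTop
      (𝓝 (partitionEntropy μ (fun y => (ξ y, ξ y)))) := by
    refine tendsto_finsetSum _ fun i _ => htend _ _
      (fun n => (hξ.prodMk (hη n)) (measurableSet_singleton i))
      ((hξ.prodMk hξ) (measurableSet_singleton i)) (fun n y hy => ?_) (fun n y hy => ?_)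
    all_goals
      intro h
      simp only [Set.mem_sdiff, mem_preimage, mem_singleton_iff] at hy
      rw [h] at hy
      exact hy.2 hy.1
  have t2 : Tendsto (fun n => partitionEntropy μ (η n)) atTop (𝓝 (partitionEntropy μ ξ)) := by
    refine tendsto_finsetSum _ fun i _ => htend _ _
      (fun n => (hη n) (measurableSet_singleton i))
      (hξ (measurableSet_singleton i)) (fun n y hy => ?_) (fun n y hy => ?_)
    all_goals
      intro h
      simp only [Set.mem_sdiff, mem_preimage, mem_singleton_iff] at hy
      rw [h] at hy
      exact hy.2 hy.1
  have e : partitionEntropy μ (fun y => (ξ y, ξ y)) = partitionEntropy μ ξ :=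
    partitionEntropy_eq μ hξ (hξ.prodMk hξ) (fun x y h => by simp [h])
      (fun x y h => (Prod.ext_iff.1 h).1)
  have t3 := t1.sub t2
  rw [e, sub_self] at t3
  have := ge_of_tendsto' t3 hbig
  linarith

end Dynamics

/-! ### Maximal entropy for a generating partition -/

section Generating

set_option linter.unusedSectionVars false

variable {Y : Type*} [MetricSpace Y] [CompactSpace Y] [MeasurableSpace Y] [BorelSpace Y]
  {N : ℕ} {g : Y → Y} {α : Y → Fin N}

/-- Any partition `ξ` is close to some `η` coarser than the `r`-th join of `α`. The `n`-join of `η`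
is coarser than the `(n + r)`-join of `α`, and passing from `η` to `ξ` costs little per step. The
bound holds for every `m`: `m = 1` gives the upper bound `log N`, general `m` gives uniqueness. -/
theorem kolmogorovEntropy_le_of_generating {μ : Measure Y} [IsProbabilityMeasure μ]
    (hg : MeasurePreserving g μ μ) (hα : Measurable α)
    (hgen : ∀ δ > 0, ∃ r, ∀ x y,
      joinPartition g α r x = joinPartition g α r y → dist x y < δ) {m : ℕ} (hm : 0 < m) :
    kolmogorovEntropy μ g ≤ ((partitionEntropy μ (joinPartition g α m) / m : ℝ) : EReal) := by
  refine iSup_le fun k => iSup_le fun ξ => iSup_le fun hξ => ?_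
  refine EReal.le_of_forall_lt_iff_le.1 fun z hz => ?_
  rw [EReal.coe_lt_coe_iff] at hz
  set H := partitionEntropy μ (joinPartition g α m) with hH
  have hH0 : 0 ≤ H := partitionEntropy_nonneg μ _
  set ε := z - H / m with hε
  have hε0 : 0 < ε := sub_pos.2 hz
  -- Half of the slack pays for the conditional entropy, the other half for the block remainder,
  -- which vanishes after division by `n`.
  obtain ⟨δ, hδ, hδ'⟩ := exists_conditionalEntropy_lt μ hξ (half_pos hε0)
  obtain ⟨r, η, hη, hηδ⟩ := exists_factorsThrough_approx (μ := μ) hgen hξ hδ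
  have hmeas : Measurable η := by
    have : Nonempty (Fin k) := (nonempty_of_isProbabilityMeasure μ).map ξ
    obtain ⟨f, rfl⟩ := (Function.factorsThrough_iff η).1 hη
    exact (measurable_of_countable f).comp (measurable_joinPartition hg.measurable hα r)
  have hcond := hδ' η hmeas hηδ
  have hbound : ∀ n : ℕ, partitionEntropy μ (joinPartition g ξ n) ≤
      (((n + r : ℕ) : ℝ) / m + 1) * H + n * (ε / 2) := by
    intro n
    have b1 := partitionEntropy_joinPartition_pair_sub_le hg hξ hmeas n
    have b2 : partitionEntropy μ (joinPartition g ξ n) ≤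
        partitionEntropy μ (fun y => (joinPartition g ξ n y, joinPartition g η n y)) :=
      partitionEntropy_mono μ ((measurable_joinPartition hg.measurable hξ n).prodMk
        (measurable_joinPartition hg.measurable hmeas n)) fun x y h => (Prod.ext_iff.1 h).1
    have b3 : partitionEntropy μ (joinPartition g η n) ≤
        partitionEntropy μ (joinPartition g α (n + r)) := by
      refine partitionEntropy_mono μ (measurable_joinPartition hg.measurable hα _)
        fun x y h => joinPartition_eq_iff.2 fun j hj => hη (joinPartition_eq_iff.2 fun i hi => ?_)
      rw [← Function.iterate_add_apply, ← Function.iterate_add_apply]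
      exact joinPartition_eq_iff.1 h (i + j) (by omega)
    have b4 := partitionEntropy_joinPartition_le hg hα hm (n + r)
    have b5 := mul_le_mul_of_nonneg_left hcond.le (Nat.cast_nonneg (α := ℝ) n)
    linarith
  have hlim : Tendsto (fun n : ℕ => ((r / m + 1) * H) / (n : ℝ)) atTop (𝓝 0) :=
    tendsto_const_div_atTop_nhds_zero_nat _
  refine limsup_le_of_le (by isBoundedDefault) ?_
  filter_upwards [hlim.eventually_lt_const (half_pos hε0), eventually_gt_atTop 0] with n hn hn0
  rw [EReal.coe_le_coe_iff]
  have hn0' : (0 : ℝ) < n := by exact_mod_cast hn0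
  have hm' : (0 : ℝ) < m := by exact_mod_cast hm
  calc partitionEntropy μ (joinPartition g ξ n) / n
      ≤ ((((n + r : ℕ) : ℝ) / m + 1) * H + n * (ε / 2)) / n := by gcongr; exact hbound n
    _ = H / m + ((r / m + 1) * H) / n + ε / 2 := by push_cast; field_simp; ring
    _ ≤ z := by linarith

/-- The atoms of small diameter that meet a set `B` cover it and stay in its `ε`-thickening. Equal
masses of atoms thus make the Lévy–Prokhorov distance zero. -/
theorem eq_of_forall_atom_eq (hg : Measurable g) (hα : Measurable α)
    (hgen : ∀ δ > 0, ∃ r, ∀ x y,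
      joinPartition g α r x = joinPartition g α r y → dist x y < δ)
    {μ ν : ProbabilityMeasure Y}
    (h : ∀ n a, (μ : Measure Y).real (joinPartition g α n ⁻¹' {a}) =
      (ν : Measure Y).real (joinPartition g α n ⁻¹' {a})) : μ = ν := by
  classical
  refine congrArg LevyProkhorov.toMeasure (a₁ := .ofMeasure μ) (a₂ := .ofMeasure ν)
    (eq_of_dist_eq_zero ?_)
  rw [LevyProkhorov.dist_probabilityMeasure_def]
  refine le_antisymm (levyProkhorovDist_le_of_forall_le _ _ le_rfl fun ε B hε hB => ?_)
    ENNReal.toReal_nonneg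
  refine le_trans ?_ le_self_add
  obtain ⟨r, hr⟩ := hgen ε hε
  have hj := measurable_joinPartition hg hα r
  let s : Finset (Fin r → Fin N) := {a | ∃ x ∈ B, joinPartition g α r x = a}
  have hU : ∀ ρ : Measure Y, IsFiniteMeasure ρ → ρ (⋃ a ∈ s, joinPartition g α r ⁻¹' {a}) =
      ∑ a ∈ s, ρ (joinPartition g α r ⁻¹' {a}) := fun ρ _ =>
    measure_biUnion_finset (fun i _ j _ hij => Disjoint.preimage _ (by simpa using hij))
      fun a _ => hj (measurableSet_singleton a)
  calc (μ : Measure Y) B ≤ (μ : Measure Y) (⋃ a ∈ s, joinPartition g α r ⁻¹' {a}) := by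
        refine measure_mono fun x hx => ?_
        simp only [mem_iUnion]
        exact ⟨joinPartition g α r x, by simpa [s] using ⟨x, hx, rfl⟩, rfl⟩
    _ = (ν : Measure Y) (⋃ a ∈ s, joinPartition g α r ⁻¹' {a}) := by
        rw [hU _ inferInstance, hU _ inferInstance]
        exact Finset.sum_congr rfl fun a _ =>
          (measureReal_eq_measureReal_iff (measure_ne_top _ _) (measure_ne_top _ _)).1 (h r a)
    _ ≤ (ν : Measure Y) (Metric.thickening ε B) := by
        refine measure_mono fun y hy => ?_
        simp only [mem_iUnion, s, Finset.mem_filter, Finset.mem_univ, true_and] at hy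
        obtain ⟨a, ⟨x, hx, rfl⟩, hy⟩ := hy
        exact Metric.mem_thickening_iff.2 ⟨x, hx, hr y x hy⟩

/-- An invariant measure that gives equal mass to the atoms of the joins of a generating
partition is the unique measure of maximal entropy. -/
theorem isEquilibriumState_iff_of_generating (hα : Measurable α)
    (hgen : ∀ δ > 0, ∃ r, ∀ x y,
      joinPartition g α r x = joinPartition g α r y → dist x y < δ)
    {μ₀ : ProbabilityMeasure Y} (hg : MeasurePreserving g (μ₀ : Measure Y) (μ₀ : Measure Y))
    (hatom : ∀ n a, (μ₀ : Measure Y).real (joinPartition g α n ⁻¹' {a}) ≤ 1 / (N : ℝ) ^ n)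
    (μ : ProbabilityMeasure Y) : IsEquilibriumState g 0 μ ↔ μ = μ₀ := by
  have hj := fun n => measurable_joinPartition hg.measurable hα n
  have : Nonempty (Fin N) := (nonempty_of_isProbabilityMeasure (μ₀ : Measure Y)).map α
  have hN : (0 : ℝ) < N := by
    exact_mod_cast Fin.pos_iff_nonempty.2 this
  have hcard : ∀ n, (Fintype.card (Fin n → Fin N) : ℝ) = (N : ℝ) ^ n := fun n => by simp
  -- There are `N ^ n` atoms of mass at most `N ^ (-n)` and total mass one, so equality holds for
  -- each.
  have hatom' : ∀ n a, (μ₀ : Measure Y).real (joinPartition g α n ⁻¹' {a}) = 1 / (N : ℝ) ^ n := by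
    intro n a
    have hsum := sum_measureReal_preimage (μ₀ : Measure Y) (hj n)
    have hsum' : ∑ _a : Fin n → Fin N, 1 / (N : ℝ) ^ n = 1 := by
      rw [Finset.sum_const, nsmul_eq_mul, Finset.card_univ, hcard]
      field_simp
    exact (Finset.sum_eq_sum_iff_of_le fun a _ => hatom n a).1 (hsum.trans hsum'.symm) a
      (Finset.mem_univ a)
  have hent : ((Real.log N : ℝ) : EReal) ≤ kolmogorovEntropy (μ₀ : Measure Y) g := by
    refine le_iSup_of_le N (le_iSup_of_le α (le_iSup_of_le hα ?_))
    refine le_of_eq (Tendsto.limsup_eq ?_).symm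
    refine tendsto_const_nhds.congr' ?_
    filter_upwards [eventually_gt_atTop 0] with n hn
    have hn' : (n : ℝ) ≠ 0 := by exact_mod_cast hn.ne'
    rw [EReal.coe_eq_coe_iff, partitionEntropy]
    simp only [hatom', Finset.sum_const, nsmul_eq_mul, Finset.card_univ, hcard, Real.negMulLog,
      one_div, Real.log_inv, Real.log_pow]
    field_simp
  have hupper : ∀ ν : ProbabilityMeasure Y, MeasurePreserving g (ν : Measure Y) (ν : Measure Y) →
      kolmogorovEntropy (ν : Measure Y) g ≤ ((Real.log N : ℝ) : EReal) := by
    intro ν hν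
    refine (kolmogorovEntropy_le_of_generating hν hα hgen one_pos).trans ?_
    rw [EReal.coe_le_coe_iff]
    have := partitionEntropy_le_log_card (ν : Measure Y) (hj 1)
    simpa using this
  constructor
  · rintro ⟨hμ, hmax⟩
    have hle := hmax μ₀ hg
    simp only [Pi.zero_apply, integral_zero, EReal.coe_zero, add_zero] at hle
    refine eq_of_forall_atom_eq hg.measurable hα hgen fun n a => ?_
    by_contra hne
    rw [hatom'] at hne
    rcases Nat.eq_zero_or_pos n with rfl | hn
    · apply hne
      have : joinPartition g α 0 ⁻¹' {a} = univ := by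
        ext y; simp only [mem_preimage, mem_singleton_iff, mem_univ, iff_true]
        exact Subsingleton.elim _ _
      simp [this]
    -- An atom of the wrong mass at level `n` pushes the entropy of the `n`-join strictly below `n
    -- log N`; the bound with `m = n` then contradicts maximality.
    have hlt := partitionEntropy_lt_log_card (μ : Measure Y) (hj n) (i := a)
      (by rwa [hcard])
    rw [hcard, Real.log_pow] at hlt
    have hn' : (0 : ℝ) < n := by exact_mod_cast hn
    have h1 := hent.trans (hle.trans (kolmogorovEntropy_le_of_generating hμ hα hgen hn))
    rw [EReal.coe_le_coe_iff, le_div_iff₀ hn'] at h1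
    linarith
  · rintro rfl
    refine ⟨hg, fun ν hν => ?_⟩
    simp only [Pi.zero_apply, integral_zero, EReal.coe_zero, add_zero]
    exact (hupper ν hν).trans hent

end Generating

/-! ### Lifts to the real line -/

/-- The displacement `U(x) - x` on `[0,1]`. -/
noncomputable def bump (x : ℝ) : ℝ := max 0 (min (x / 2) (min (1 / 16) (1 / 4 - x / 2)))

/-- The lift of `U` to the real line. -/
noncomputable def uLift (x : ℝ) : ℝ := x + bump (Int.fract x)

theorem uFormula_eq {x : ℝ} (h0 : 0 ≤ x) : uFormula x = x + bump x := by
  simp only [uFormula, bump]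
  split_ifs with h1 h2 h3
  · rw [min_eq_left (by rw [le_min_iff]; constructor <;> linarith), max_eq_right (by linarith)]
    ring
  · rw [min_eq_left (a := (1 / 16 : ℝ)) (by linarith), min_eq_right (by linarith),
      max_eq_right (by norm_num)]
  · rw [min_eq_right (a := (1 / 16 : ℝ)) (by linarith), min_eq_right (by linarith),
      max_eq_right (by linarith)]
    ring
  · rw [max_eq_left]
    · ring
    · exact (min_le_right _ _).trans ((min_le_right _ _).trans (by linarith))

theorem bump_nonneg (x : ℝ) : 0 ≤ bump x := le_max_left _ _

theorem bump_le_left {x : ℝ} (h : 0 ≤ x) : bump x ≤ x / 2 :=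
  max_le (by linarith) (min_le_left _ _)

theorem bump_le_right {x : ℝ} (h : x ≤ 1) : bump x ≤ (1 - x) / 2 :=
  max_le (by linarith) ((min_le_right _ _).trans ((min_le_right _ _).trans (by linarith)))

theorem bump_le_one (x : ℝ) : bump x ≤ 1 :=
  max_le zero_le_one ((min_le_right _ _).trans ((min_le_left _ _).trans (by norm_num)))

theorem abs_bump_sub_le (x y : ℝ) : |bump x - bump y| ≤ |x - y| / 2 := by
  have h1 : |x / 2 - y / 2| ≤ |x - y| / 2 := by
    rw [← sub_div, abs_div, abs_of_pos (zero_lt_two' ℝ)]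
  have h2 : |(1 / 4 - x / 2) - (1 / 4 - y / 2)| ≤ |x - y| / 2 := by
    rw [show (1 / 4 - x / 2) - (1 / 4 - y / 2) = -(x / 2 - y / 2) by ring, abs_neg]
    exact h1
  have h3 : (0 : ℝ) ≤ |x - y| / 2 := by positivity
  refine (abs_max_sub_max_le_max _ _ _ _).trans (max_le (by simpa) ?_)
  refine (abs_min_sub_min_le_max _ _ _ _).trans (max_le h1 ?_)
  exact (abs_min_sub_min_le_max _ _ _ _).trans (max_le (by simpa) h2)

/-- The displacement vanishes at `0` and `1`, so its periodic extension remains Lipschitz with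
constant `1/2` across integers: there both values are bounded by half the distance to an integer
between `x` and `y`. -/
theorem abs_bump_fract_sub_le {x y : ℝ} (hxy : x ≤ y) :
    |bump (Int.fract x) - bump (Int.fract y)| ≤ (y - x) / 2 := by
  have ex := Int.floor_add_fract x
  have ey := Int.floor_add_fract y
  rcases (Int.floor_mono hxy).eq_or_lt with h | h
  · refine (abs_bump_sub_le _ _).trans ?_
    rw [abs_sub_comm, abs_of_nonneg]
    · rw [← h] at ey; linarith
    · rw [← h] at ey; linarith
  · have h' : (⌊x⌋ : ℝ) + 1 ≤ ⌊y⌋ := by exact_mod_cast h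
    have b1 := bump_le_right (Int.fract_lt_one x).le
    have b2 := bump_le_left (Int.fract_nonneg y)
    have b3 := bump_nonneg (Int.fract x)
    have b4 := bump_nonneg (Int.fract y)
    have := Int.fract_nonneg y
    have := Int.fract_lt_one x
    rw [abs_le]
    constructor <;> linarith

theorem uLift_sub_ge {x y : ℝ} (hxy : x ≤ y) : (y - x) / 2 ≤ uLift y - uLift x := by
  have := abs_le.1 (abs_bump_fract_sub_le hxy)
  simp only [uLift]
  linarith

theorem uLift_sub_le {x y : ℝ} (hxy : x ≤ y) : uLift y - uLift x ≤ 3 / 2 * (y - x) := by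
  have := abs_le.1 (abs_bump_fract_sub_le hxy)
  simp only [uLift]
  linarith

theorem uLift_add_int (x : ℝ) (k : ℤ) : uLift (x + k) = uLift x + k := by
  simp only [uLift, Int.fract_add_intCast]; ring

theorem uLift_zero : uLift 0 = 0 := by simp [uLift, bump]

/-- A real function that increases at least with slope `c > 0` and at most with slope `C`. -/
structure HasSlopesIn (c C : ℝ) (F : ℝ → ℝ) : Prop where
  ge : ∀ ⦃x y⦄, x ≤ y → c * (y - x) ≤ F y - F x
  le : ∀ ⦃x y⦄, x ≤ y → F y - F x ≤ C * (y - x)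

namespace HasSlopesIn

variable {c C c' C' : ℝ} {F F' : ℝ → ℝ}

theorem abs_ge (h : HasSlopesIn c C F) (x y : ℝ) : c * |x - y| ≤ |F x - F y| := by
  rcases le_total x y with hxy | hxy
  · rw [abs_sub_comm, abs_of_nonneg (sub_nonneg.2 hxy), abs_sub_comm]
    exact (h.ge hxy).trans (le_abs_self _)
  · rw [abs_of_nonneg (sub_nonneg.2 hxy)]
    exact (h.ge hxy).trans (le_abs_self _)

theorem abs_le (h : HasSlopesIn c C F) (x y : ℝ) (hc : 0 < c) : |F x - F y| ≤ C * |x - y| := by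
  wlog hxy : y ≤ x generalizing x y
  · rw [abs_sub_comm, abs_sub_comm x]
    exact this y x (le_of_not_ge hxy)
  have h1 := h.ge hxy
  have h2 : 0 ≤ c * (x - y) := mul_nonneg hc.le (sub_nonneg.2 hxy)
  rw [abs_of_nonneg (sub_nonneg.2 hxy), abs_of_nonneg (h2.trans h1)]
  exact h.le hxy

theorem strictMono (h : HasSlopesIn c C F) (hc : 0 < c) : StrictMono F := fun x y hxy => by
  have := h.ge hxy.le
  have h2 : 0 < c * (y - x) := mul_pos hc (sub_pos.2 hxy)
  linarith

theorem continuous (h : HasSlopesIn c C F) (hc : 0 < c) : Continuous F := by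
  have hC : 0 ≤ C := by
    have h1 := h.ge zero_le_one
    have h2 := h.le zero_le_one
    linarith
  exact (LipschitzWith.of_dist_le_mul (K := ⟨C, hC⟩) fun x y => h.abs_le x y hc).continuous

theorem surjective (h : HasSlopesIn c C F) (hc : 0 < c) : Function.Surjective F := by
  refine (h.continuous hc).surjective ?_ ?_
  · refine tendsto_atTop_mono' _ (f₁ := fun x => F 0 + c * x) ?_
      (tendsto_atTop_add_const_left _ _ (tendsto_id.const_mul_atTop hc))
    filter_upwards [eventually_ge_atTop 0] with x hx
    have := h.ge hx
    linarith
  · refine tendsto_atBot_mono' _ (f₁ := fun x => F 0 + c * x) ?_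
      (tendsto_atBot_add_const_left _ _ (tendsto_id.const_mul_atBot hc))
    filter_upwards [eventually_le_atBot 0] with x hx
    have := h.ge hx
    linarith

theorem comp (h : HasSlopesIn c C F) (h' : HasSlopesIn c' C' F') (hc : 0 < c) (hC : 0 ≤ C)
    (hc' : 0 < c') : HasSlopesIn (c * c') (C * C') (F ∘ F') where
  ge x y hxy := by
    refine le_trans ?_ (h.ge ((h'.strictMono hc').monotone hxy))
    rw [mul_assoc]
    exact mul_le_mul_of_nonneg_left (h'.ge hxy) hc.le
  le x y hxy := by
    refine (h.le ((h'.strictMono hc').monotone hxy)).trans ?_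
    rw [mul_assoc]
    exact mul_le_mul_of_nonneg_left (h'.le hxy) hC

end HasSlopesIn

theorem hasSlopesIn_uLift : HasSlopesIn (1 / 2) (3 / 2) uLift where
  ge x y hxy := by have := uLift_sub_ge hxy; linarith
  le x y hxy := uLift_sub_le hxy

/-- The lift of `U` as an order isomorphism. -/
noncomputable def uIso : ℝ ≃o ℝ :=
  (hasSlopesIn_uLift.strictMono one_half_pos).orderIsoOfSurjective _
    (hasSlopesIn_uLift.surjective one_half_pos)

theorem uIso_apply (x : ℝ) : uIso x = uLift x := rfl

theorem uIso_symm_add_int (x : ℝ) (k : ℤ) : uIso.symm (x + k) = uIso.symm x + k := by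
  rw [OrderIso.symm_apply_eq, uIso_apply, uLift_add_int, ← uIso_apply, OrderIso.apply_symm_apply]

theorem uIso_symm_int (k : ℤ) : uIso.symm k = k := by
  rw [OrderIso.symm_apply_eq, uIso_apply, ← zero_add (k : ℝ), uLift_add_int, uLift_zero]

theorem hasSlopesIn_uIso_symm : HasSlopesIn (2 / 3) 2 uIso.symm where
  ge x y hxy := by
    have := uLift_sub_le (uIso.symm.monotone hxy)
    simp only [← uIso_apply, OrderIso.apply_symm_apply] at this
    linarith
  le x y hxy := by
    have := uLift_sub_ge (uIso.symm.monotone hxy)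
    simp only [← uIso_apply, OrderIso.apply_symm_apply] at this
    linarith

/-! ### Circle maps and their lifts -/

theorem coe_eq_coe_iff {x y : ℝ} : (x : X) = (y : X) ↔ ∃ k : ℤ, y = x + k := by
  rw [eq_comm, ← sub_eq_zero, ← AddCircle.coe_sub, AddCircle.coe_eq_zero_iff]
  refine exists_congr fun k => ?_
  rw [zsmul_eq_mul, mul_one, eq_sub_iff_add_eq, add_comm, eq_comm]

theorem coe_fract (x : ℝ) : ((Int.fract x : ℝ) : X) = x :=
  coe_eq_coe_iff.2 ⟨⌊x⌋, (Int.fract_add_floor x).symm⟩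

theorem fract_mem_Ico (x : ℝ) : Int.fract x ∈ Ico (0 : ℝ) (0 + 1) := by
  rw [zero_add]; exact ⟨Int.fract_nonneg x, Int.fract_lt_one x⟩

theorem equivIco_coe (x : ℝ) : AddCircle.equivIco (1 : ℝ) 0 (x : X) = Int.fract x := by
  rw [← coe_fract, AddCircle.equivIco_coe_of_mem (fract_mem_Ico x)]

theorem U_coe (x : ℝ) : U (x : X) = (uLift x : X) := by
  have h : U (x : X) = (uFormula (Int.fract x) : X) := by
    rw [← equivIco_coe]
    rfl
  rw [h, uFormula_eq (Int.fract_nonneg x), coe_eq_coe_iff]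
  refine ⟨⌊x⌋, ?_⟩
  have := Int.fract_add_floor x
  rw [uLift]
  linarith

theorem U_symm_coe (x : ℝ) : U.symm (x : X) = (uIso.symm x : X) := by
  rw [Equiv.symm_apply_eq, U_coe, ← uIso_apply, OrderIso.apply_symm_apply]

/-- The lifts of the two generators. -/
noncomputable def genLift (i : Fin 2) (x : ℝ) : ℝ :=
  if i = 0 then 4 * x else uIso.symm (4 * uLift x)

/-- Slopes multiply: `4/3 = (2/3) * 4 * (1/2)` and `12 = 2 * 4 * (3/2)`. That the lower bound
exceeds one drives all later estimates. -/
theorem hasSlopesIn_genLift (i : Fin 2) : HasSlopesIn (4 / 3) 12 (genLift i) := by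
  unfold genLift
  split_ifs
  · constructor <;> intro x y hxy <;> linarith
  · have h4 : HasSlopesIn 4 4 (fun x : ℝ => 4 * x) := by
      constructor <;> intro x y hxy <;> linarith
    have := (hasSlopesIn_uIso_symm.comp h4 (by norm_num) (by norm_num) (by norm_num)).comp
      hasSlopesIn_uLift (by norm_num) (by norm_num) (by norm_num)
    norm_num at this
    exact this

theorem genLift_add_int (i : Fin 2) (x : ℝ) (k : ℤ) :
    genLift i (x + k) = genLift i x + 4 * k := by
  unfold genLift
  split_ifs
  · ring
  · rw [uLift_add_int, mul_add]
    exact_mod_cast uIso_symm_add_int _ (4 * k)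

theorem genLift_zero (i : Fin 2) : genLift i 0 = 0 := by
  unfold genLift
  split_ifs
  · simp
  · simpa [uLift_zero] using uIso_symm_int 0

theorem gen_coe (i : Fin 2) (x : ℝ) : gen i (x : X) = (genLift i x : X) := by
  have hT : ∀ y : ℝ, T (y : X) = ((4 * y : ℝ) : X) := fun y => by
    rw [T, ← AddCircle.coe_nsmul]; simp
  unfold genLift
  fin_cases i
  · exact hT x
  · change U.symm (T (U (x : X))) = _
    rw [U_coe, hT, U_symm_coe]
    simp

/-- The lift of `U` moves points by at most one, which counts four times before the inverse is
applied and once after it. -/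
theorem abs_genLift_sub_le (i : Fin 2) (x : ℝ) : |genLift i x - 4 * x| ≤ 5 := by
  have hb : ∀ y, |uLift y - y| ≤ 1 := fun y => by
    rw [uLift, add_sub_cancel_left, abs_of_nonneg (bump_nonneg _)]
    exact bump_le_one _
  unfold genLift
  split_ifs
  · simp
  · have h1 := abs_le.1 (hb x)
    have h2 := abs_le.1 (hb (uIso.symm (4 * uLift x)))
    rw [← uIso_apply (uIso.symm _), OrderIso.apply_symm_apply] at h2
    rw [abs_le]
    constructor <;> linarith

/-- The point that the generator `i` maps to `0` after one full turn. -/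
noncomputable def firstBreak (i : Fin 2) : ℝ := if i = 0 then 1 / 4 else 3 / 16

/-- These points tell the two letters apart. For `S`, note that `U` carries `3/16` to `1/4`. -/
theorem genLift_firstBreak (i : Fin 2) : genLift i (firstBreak i) = 1 := by
  unfold genLift firstBreak
  split_ifs
  · norm_num
  · have : uLift (3 / 16) = 1 / 4 := by
      rw [uLift, Int.fract_eq_self.2 (by norm_num), bump]
      norm_num
    rw [this]
    simpa using uIso_symm_int 1

theorem firstBreak_injective : Function.Injective firstBreak := by
  intro i j h
  fin_cases i <;> fin_cases j <;> first | rfl | (norm_num [firstBreak] at h)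

/-- `F` is a lift of a piecewise expanding circle map of degree `4 ^ n`. -/
structure IsLift (n : ℕ) (F : ℝ → ℝ) : Prop where
  slopes : HasSlopesIn ((4 / 3) ^ n) (12 ^ n) F
  add_int : ∀ (x : ℝ) (k : ℤ), F (x + k) = F x + 4 ^ n * k
  zero : F 0 = 0

namespace IsLift

variable {n : ℕ} {F : ℝ → ℝ}

theorem id : IsLift 0 id where
  slopes := by constructor <;> intro x y hxy <;> simp
  add_int x k := by simp
  zero := rfl

theorem genLift_comp (h : IsLift n F) (i : Fin 2) : IsLift (n + 1) (genLift i ∘ F) where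
  slopes := by
    have := (hasSlopesIn_genLift i).comp h.slopes (by norm_num) (by norm_num) (by positivity)
    rwa [← pow_succ', ← pow_succ'] at this
  add_int x k := by
    simp only [Function.comp_apply, h.add_int]
    have := genLift_add_int i (F x) (4 ^ n * k)
    push_cast at this
    rw [this]; ring
  zero := by simp [h.zero, genLift_zero]

theorem strictMono (h : IsLift n F) : StrictMono F := h.slopes.strictMono (by positivity)
theorem continuous (h : IsLift n F) : Continuous F := h.slopes.continuous (by positivity)
theorem surjective (h : IsLift n F) : Function.Surjective F := h.slopes.surjective (by positivity)

theorem int (h : IsLift n F) (k : ℤ) : F k = 4 ^ n * k := by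
  have := h.add_int 0 k
  rwa [zero_add, h.zero, zero_add] at this

end IsLift

/-! ### The conjugacies -/

/-- The lift of `g_{i_n} ∘ ⋯ ∘ g_{i_1}`. -/
noncomputable def liftIter (σ : LeftWord) : ℕ → ℝ → ℝ
  | 0 => id
  | n + 1 => genLift (σ n) ∘ liftIter σ n

theorem isLift_liftIter (σ : LeftWord) (n : ℕ) : IsLift n (liftIter σ n) := by
  induction n with
  | zero => exact IsLift.id
  | succ n ih => exact ih.genLift_comp _

/-- The recursion adds the letter applied last; here the letter applied first is split off, as the
functional equation of `conj` requires. -/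
theorem liftIter_shift (σ : LeftWord) (n : ℕ) (x : ℝ) :
    liftIter (fun k => σ (k + 1)) n (genLift (σ 0) x) = liftIter σ (n + 1) x := by
  induction n with
  | zero => rfl
  | succ n ih => exact congrArg (genLift (σ (n + 1))) ih

theorem liftIter_congr {σ τ : LeftWord} {n : ℕ} (h : ∀ k < n, σ k = τ k) :
    liftIter σ n = liftIter τ n := by
  induction n with
  | zero => rfl
  | succ n ih =>
    rw [liftIter, liftIter, ih fun k hk => h k (hk.trans n.lt_succ_self), h n n.lt_succ_self]

theorem truncation_map_coe (σ : LeftWord) (n : ℕ) (x : ℝ) :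
    (truncation σ n).1.map (x : X) = (liftIter σ (n + 1) x : X) := by
  induction n with
  | zero => exact gen_coe _ x
  | succ n ih =>
    change gen (σ (n + 1)) ((truncation σ n).1.map (x : X)) = _
    rw [ih, gen_coe]
    rfl

theorem cauchySeq_liftIter_div (σ : LeftWord) (x : ℝ) :
    CauchySeq fun n => liftIter σ n x / 4 ^ n := by
  refine cauchySeq_of_le_geometric (1 / 4) 5 (by norm_num) fun n => ?_
  have h := abs_genLift_sub_le (σ n) (liftIter σ n x)
  have e : liftIter σ n x / 4 ^ n - liftIter σ (n + 1) x / 4 ^ (n + 1) =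
      -((genLift (σ n) (liftIter σ n x) - 4 * liftIter σ n x) / 4 ^ (n + 1)) := by
    rw [liftIter, Function.comp_apply, pow_succ]
    field_simp
    ring
  rw [Real.dist_eq, e, abs_neg, abs_div, abs_of_pos (by positivity : (0 : ℝ) < 4 ^ (n + 1))]
  calc _ ≤ 5 / (4 : ℝ) ^ (n + 1) := by gcongr
    _ ≤ 5 / (4 : ℝ) ^ n := by gcongr <;> norm_num
    _ = _ := by rw [one_div, inv_pow]; rfl

/-- The conjugacy attached to a left-infinite word, on the real line. -/
noncomputable def conj (σ : LeftWord) (x : ℝ) : ℝ :=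
  limUnder atTop fun n => liftIter σ n x / 4 ^ n

theorem tendsto_conj (σ : LeftWord) (x : ℝ) :
    Tendsto (fun n => liftIter σ n x / 4 ^ n) atTop (𝓝 (conj σ x)) :=
  (cauchySeq_liftIter_div σ x).tendsto_limUnder

theorem conj_add_int (σ : LeftWord) (x : ℝ) (k : ℤ) : conj σ (x + k) = conj σ x + k := by
  refine tendsto_nhds_unique (tendsto_conj σ (x + k))
    (((tendsto_conj σ x).add_const (k : ℝ)).congr fun n => ?_)
  rw [(isLift_liftIter σ n).add_int]
  field_simp

theorem conj_int (σ : LeftWord) (k : ℤ) : conj σ k = k := by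
  refine tendsto_nhds_unique (tendsto_conj σ k) (tendsto_const_nhds.congr fun n => ?_)
  rw [(isLift_liftIter σ n).int]
  field_simp

theorem conj_monotone (σ : LeftWord) : Monotone (conj σ) := fun x y hxy =>
  le_of_tendsto_of_tendsto' (tendsto_conj σ x) (tendsto_conj σ y) fun n => by
    have := (isLift_liftIter σ n).strictMono.monotone hxy
    gcongr

theorem abs_conj_sub_le (σ : LeftWord) (x : ℝ) : |conj σ x - x| ≤ 1 := by
  have h1 := conj_monotone σ (Int.floor_le x)
  have h2 := conj_monotone σ (Int.lt_floor_add_one x).le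
  rw [← Int.cast_one, conj_add_int, conj_int, Int.cast_one] at h2
  rw [conj_int] at h1
  have h3 := Int.floor_le x
  have h4 := Int.lt_floor_add_one x
  rw [abs_le]
  constructor <;> linarith

/-- The functional equation results from the limit in `liftIter_shift`; the factor `4` comes from
dividing by `4 ^ n` instead of `4 ^ (n + 1)`. -/
theorem conj_shift (σ : LeftWord) (x : ℝ) :
    conj (fun k => σ (k + 1)) (genLift (σ 0) x) = 4 * conj σ x := by
  refine tendsto_nhds_unique (tendsto_conj _ _)
    ((((tendsto_add_atTop_iff_nat 1).2 (tendsto_conj σ x)).const_mul 4).congr fun n => ?_)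
  rw [liftIter_shift, pow_succ]
  field_simp

theorem conj_liftIter (σ : LeftWord) (n : ℕ) (x : ℝ) :
    conj (fun k => σ (k + n)) (liftIter σ n x) = 4 ^ n * conj σ x := by
  induction n with
  | zero => simp [liftIter]
  | succ n ih =>
    have := conj_shift (fun k => σ (k + n)) (liftIter σ n x)
    rw [ih, zero_add] at this
    rw [pow_succ', mul_assoc, ← this, liftIter, Function.comp_apply]
    congr 2
    ext k
    congr 2
    ring

/-- By `conj_liftIter` the difference is that between a point and its image under another conjugacy,
and conjugacies stay within one of the identity. -/
theorem abs_liftIter_sub_le (σ : LeftWord) (n : ℕ) (x : ℝ) :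
    |liftIter σ n x - 4 ^ n * conj σ x| ≤ 1 := by
  rw [← conj_liftIter, abs_sub_comm]
  exact abs_conj_sub_le _ _

theorem conj_strictMono (σ : LeftWord) : StrictMono (conj σ) := by
  intro x y hxy
  -- The iterate separates the points by more than `3`, while replacing it by `4 ^ n * conj σ` at
  -- both points costs at most `2`.
  obtain ⟨n, hn⟩ := pow_unbounded_of_one_lt (3 / (y - x)) (by norm_num : (1 : ℝ) < 4 / 3)
  rw [div_lt_iff₀ (sub_pos.2 hxy)] at hn
  have h1 := (isLift_liftIter σ n).slopes.ge hxy.le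
  have h2 := abs_le.1 (abs_liftIter_sub_le σ n x)
  have h3 := abs_le.1 (abs_liftIter_sub_le σ n y)
  have h4 : (0 : ℝ) < 4 ^ n := by positivity
  exact lt_of_mul_lt_mul_left (a := (4 : ℝ) ^ n) (by linarith) h4.le

theorem conj_continuous (σ : LeftWord) : Continuous (conj σ) := by
  have hu : TendstoUniformly (fun n x => liftIter σ n x / 4 ^ n) (conj σ) atTop := by
    rw [Metric.tendstoUniformly_iff]
    intro ε hε
    have h0 : Tendsto (fun n : ℕ => (1 / 4 : ℝ) ^ n) atTop (𝓝 0) :=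
      tendsto_pow_atTop_nhds_zero_of_lt_one (by norm_num) (by norm_num)
    filter_upwards [h0.eventually_lt_const hε] with n hn x
    refine lt_of_le_of_lt ?_ hn
    have h4 : (0 : ℝ) < 4 ^ n := by positivity
    have e : liftIter σ n x / 4 ^ n - conj σ x = (liftIter σ n x - 4 ^ n * conj σ x) / 4 ^ n := by
      field_simp
    rw [dist_comm, Real.dist_eq, e, abs_div, abs_of_pos h4, div_pow, one_pow]
    exact div_le_div_of_nonneg_right (abs_liftIter_sub_le σ n x) h4.le
  exact hu.continuous (Frequently.of_forall fun n =>
    (isLift_liftIter σ n).continuous.div_const _)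

theorem conj_surjective (σ : LeftWord) : Function.Surjective (conj σ) := by
  refine (conj_continuous σ).surjective ?_ ?_
  · exact tendsto_atTop_mono (fun x => by
      have := abs_le.1 (abs_conj_sub_le σ x)
      simp only [id_eq]
      linarith)
      (tendsto_atTop_add_const_right atTop (-1 : ℝ) tendsto_id)
  · exact tendsto_atBot_mono (fun x => by
      have := abs_le.1 (abs_conj_sub_le σ x)
      simp only [id_eq]
      linarith)
      (tendsto_atBot_add_const_right atBot (1 : ℝ) tendsto_id)

/-- The conjugacy as an order isomorphism of the real line. -/
noncomputable def conjIso (σ : LeftWord) : ℝ ≃o ℝ :=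
  (conj_strictMono σ).orderIsoOfSurjective _ (conj_surjective σ)

theorem conjIso_apply (σ : LeftWord) (x : ℝ) : conjIso σ x = conj σ x := rfl

theorem conj_conjIso_symm (σ : LeftWord) (y : ℝ) : conj σ ((conjIso σ).symm y) = y :=
  (conjIso σ).apply_symm_apply y

theorem conjIso_symm_add_int (σ : LeftWord) (y : ℝ) (k : ℤ) :
    (conjIso σ).symm (y + k) = (conjIso σ).symm y + k := by
  rw [OrderIso.symm_apply_eq, conjIso_apply, conj_add_int, conj_conjIso_symm]

/-- Words with a long common beginning have close conjugacies. -/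
theorem abs_conjIso_symm_sub_le {σ τ : LeftWord} {n : ℕ} (h : ∀ k < n, σ k = τ k) (y : ℝ) :
    |(conjIso σ).symm y - (conjIso τ).symm y| ≤ 2 * (3 / 4) ^ n := by
  -- The common iterate takes both preimages of `y` to within one of `4 ^ n * y`; its expansion by
  -- `(4/3) ^ n` makes the preimages close.
  have h1 := abs_le.1 (abs_liftIter_sub_le σ n ((conjIso σ).symm y))
  have h2 := abs_le.1 (abs_liftIter_sub_le τ n ((conjIso τ).symm y))
  rw [conj_conjIso_symm] at h1 h2
  rw [liftIter_congr h] at h1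
  have h3 := (isLift_liftIter τ n).slopes.abs_ge ((conjIso σ).symm y) ((conjIso τ).symm y)
  have h4 : |liftIter τ n ((conjIso σ).symm y) - liftIter τ n ((conjIso τ).symm y)| ≤ 2 := by
    rw [abs_le]; constructor <;> linarith
  have h5 : ((3 : ℝ) / 4) ^ n * (4 / 3) ^ n = 1 := by rw [← mul_pow]; norm_num
  have h6 := mul_le_mul_of_nonneg_left (h3.trans h4) (by positivity : (0 : ℝ) ≤ (3 / 4) ^ n)
  rw [← mul_assoc, h5, one_mul] at h6
  linarith

/-- The conjugacy determines the word. -/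
theorem conj_injective : Function.Injective conj := by
  have h0 : ∀ {σ τ : LeftWord}, conj σ = conj τ → σ 0 = τ 0 := by
    intro σ τ h
    -- Every conjugacy takes the value `1/4` at the break point of its first letter, hence reveals
    -- that letter.
    have e : ∀ ρ : LeftWord, 4 * conj ρ (firstBreak (ρ 0)) = 1 := fun ρ => by
      rw [← conj_shift, genLift_firstBreak]
      exact_mod_cast conj_int _ 1
    refine firstBreak_injective ((conj_strictMono σ).injective ?_)
    have h1 := e σ
    have h2 := e τ
    rw [← h] at h2
    linarith
  have hs : ∀ {σ τ : LeftWord}, conj σ = conj τ →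
      conj (fun k => σ (k + 1)) = conj (fun k => τ (k + 1)) := by
    intro σ τ h
    funext y
    -- The first letters agree, so one preimage `x` serves in the functional equations of both
    -- words.
    obtain ⟨x, rfl⟩ := (hasSlopesIn_genLift (σ 0)).surjective (by norm_num) y
    rw [conj_shift, h, ← conj_shift, h0 h]
  have hn : ∀ (n : ℕ) {σ τ : LeftWord}, conj σ = conj τ → σ n = τ n := by
    intro n
    induction n with
    | zero => exact h0
    | succ n ih => exact fun h => ih (hs h)
  exact fun σ τ h => funext fun n => hn n h

/-! ### The conjugacies on the circle -/

/-- The circle map with lift `F`, for `F` of degree one. -/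
noncomputable def circleMap (F : ℝ → ℝ) (hF : ∀ (x : ℝ) (k : ℤ), F (x + k) = F x + k) : X → X :=
  Function.Periodic.lift (f := fun x => (F x : X)) fun x => by
    have := hF x 1
    rw [Int.cast_one] at this
    change (F (x + 1) : X) = F x
    rw [this, coe_eq_coe_iff]
    exact ⟨-1, by simp⟩

theorem circleMap_coe (F : ℝ → ℝ) (hF : ∀ (x : ℝ) (k : ℤ), F (x + k) = F x + k) (x : ℝ) :
    circleMap F hF (x : X) = (F x : X) := rfl

theorem continuous_circleMap {F : ℝ → ℝ} (hc : Continuous F)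
    (hF : ∀ (x : ℝ) (k : ℤ), F (x + k) = F x + k) : Continuous (circleMap F hF) :=
  continuous_coinduced_dom.2 ((AddCircle.continuous_mk' 1).comp hc)

/-- The conjugacy as a homeomorphism of the circle. -/
noncomputable def circleConj (σ : LeftWord) : X ≃ₜ X where
  toFun := circleMap (conj σ) (conj_add_int σ)
  invFun := circleMap (conjIso σ).symm (conjIso_symm_add_int σ)
  left_inv z := by
    induction z using QuotientAddGroup.induction_on with | _ x =>
    rw [circleMap_coe, circleMap_coe, ← conjIso_apply, OrderIso.symm_apply_apply]
  right_inv z := by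
    induction z using QuotientAddGroup.induction_on with | _ x =>
    rw [circleMap_coe, circleMap_coe, conj_conjIso_symm]
  continuous_toFun := continuous_circleMap (conj_continuous σ) _
  continuous_invFun := continuous_circleMap (conjIso σ).symm.continuous _

theorem circleConj_coe (σ : LeftWord) (x : ℝ) : circleConj σ (x : X) = (conj σ x : X) := rfl

theorem circleConj_symm_coe (σ : LeftWord) (y : ℝ) :
    (circleConj σ).symm (y : X) = ((conjIso σ).symm y : X) := rfl

/-- For a periodic word, dropping a whole period restores the word, so the semiconjugacy of
`conj_liftIter` becomes a conjugacy with multiplication by `4 ^ (n + 1)`. -/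
theorem circleConj_truncation (σ : LeftWord) (n : ℕ) (hσ : ∀ k, σ (k + (n + 1)) = σ k) (z : X) :
    circleConj σ ((truncation σ n).1.map z) = (4 ^ (n + 1)) • circleConj σ z := by
  induction z using QuotientAddGroup.induction_on with | _ x =>
  have := conj_liftIter σ (n + 1) x
  simp only [hσ] at this
  rw [truncation_map_coe, circleConj_coe, circleConj_coe, this, ← AddCircle.coe_nsmul]
  simp

/-! ### Multiplication by `N` on the circle -/

/-- The coordinate of a point of the circle in `[0,1)`. -/
noncomputable def coord (z : X) : ℝ := AddCircle.equivIco (1 : ℝ) 0 z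

theorem coord_coe (x : ℝ) : coord (x : X) = Int.fract x := equivIco_coe x

theorem coe_coord (z : X) : (coord z : X) = z := AddCircle.coe_equivIco

theorem coord_mem (z : X) : coord z ∈ Ico (0 : ℝ) 1 := by
  obtain ⟨h0, h1⟩ := (AddCircle.equivIco (1 : ℝ) 0 z).2
  exact ⟨h0, h1.trans_eq (zero_add 1)⟩

theorem measurable_coord : Measurable coord :=
  measurable_subtype_coe.comp (AddCircle.measurableEquivIco 1 0).measurable

theorem dist_coe_le (x y : ℝ) : dist (x : X) (y : X) ≤ |x - y| := by
  rw [dist_eq_norm, ← AddCircle.coe_sub, UnitAddCircle.norm_eq]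
  simpa using round_le (x - y) 0

theorem dist_le_abs_coord_sub (z w : X) : dist z w ≤ |coord z - coord w| := by
  simpa only [coe_coord] using dist_coe_le (coord z) (coord w)

theorem measurePreserving_coe_Ico :
    MeasurePreserving ((↑) : ℝ → X) (volume.restrict (Ico 0 1)) volume := by
  have := UnitAddCircle.measurePreserving_mk 0
  rwa [zero_add, ← Measure.restrict_congr_set Ico_ae_eq_Ioc] at this

instance isProbabilityMeasure_volume_circle : IsProbabilityMeasure (volume : Measure X) :=
  ⟨UnitAddCircle.measure_univ⟩

theorem volume_circle_eq {A : Set X} (hA : MeasurableSet A) :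
    volume A = volume (((↑) : ℝ → X) ⁻¹' A ∩ Ico 0 1) := by
  rw [← measurePreserving_coe_Ico.measure_preimage hA.nullMeasurableSet,
    Measure.restrict_apply' measurableSet_Ico]

/-- The first digit in base `N`. -/
noncomputable def digit (N : ℕ) (hN : 0 < N) (z : X) : Fin N :=
  ⟨⌊N * coord z⌋₊, by
    have hN' : (0 : ℝ) < N := by exact_mod_cast hN
    rw [Nat.floor_lt (mul_nonneg hN'.le (coord_mem z).1)]
    exact mul_lt_of_lt_one_right hN' (coord_mem z).2⟩

theorem measurable_digit (N : ℕ) (hN : 0 < N) : Measurable (digit N hN) := by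
  refine measurable_to_countable' fun i => ?_
  have : digit N hN ⁻¹' {i} = (fun z => ⌊(N : ℝ) * coord z⌋₊) ⁻¹' {(i : ℕ)} := by
    ext z
    simp [digit, Fin.ext_iff]
  rw [this]
  exact (Nat.measurable_floor.comp (measurable_coord.const_mul _)) (measurableSet_singleton _)

/-- Between points with the same first digit, multiplication by `N` scales coordinate differences by
exactly `N`, because the same integer is subtracted from both. -/
theorem abs_coord_sub_le (N : ℕ) (hN : 0 < N) (n : ℕ) (z w : X)
    (h : joinPartition (fun y : X => N • y) (digit N hN) n z =
      joinPartition (fun y : X => N • y) (digit N hN) n w) :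
    |coord z - coord w| ≤ 1 / (N : ℝ) ^ n := by
  have hN' : (0 : ℝ) < N := by exact_mod_cast hN
  induction n generalizing z w with
  | zero =>
    obtain ⟨h1, h2⟩ := coord_mem z
    obtain ⟨h3, h4⟩ := coord_mem w
    rw [pow_zero, div_one, abs_le]
    constructor <;> linarith
  | succ n ih =>
    rw [joinPartition_eq_iff] at h
    have h0 := h 0 n.succ_pos
    have hstep := ih (N • z) (N • w) (joinPartition_eq_iff.2 fun j hj => by
      have := h (j + 1) (Nat.succ_lt_succ hj)
      rwa [Function.iterate_succ_apply, Function.iterate_succ_apply] at this)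
    have hc : ∀ y : X, coord (N • y) = N * coord y - ⌊(N : ℝ) * coord y⌋₊ := by
      intro y
      conv_lhs => rw [← coe_coord y, ← AddCircle.coe_nsmul, coord_coe, nsmul_eq_mul]
      rw [Int.fract, natCast_floor_eq_intCast_floor (mul_nonneg hN'.le (coord_mem y).1)]
    have h0' : ⌊(N : ℝ) * coord z⌋₊ = ⌊(N : ℝ) * coord w⌋₊ := by
      simpa [digit, Fin.ext_iff] using h0
    rw [hc, hc, h0', sub_sub_sub_cancel_right, ← mul_sub, abs_mul, abs_of_pos hN'] at hstep
    rw [pow_succ', ← div_div, div_right_comm, le_div_iff₀ hN', mul_comm]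
    exact hstep

theorem volume_atom_le (N : ℕ) (hN : 0 < N) (n : ℕ) (a : Fin n → Fin N) :
    (volume : Measure X).real
      (joinPartition (fun y : X => N • y) (digit N hN) n ⁻¹' {a}) ≤ 1 / (N : ℝ) ^ n := by
  have hm : MeasurableSet (joinPartition (fun y : X => N • y) (digit N hN) n ⁻¹' {a}) :=
    measurable_joinPartition (continuous_nsmul N).measurable (measurable_digit N hN) n
      (measurableSet_singleton a)
  refine ENNReal.toReal_le_of_le_ofReal (by positivity) ?_
  rw [volume_circle_eq hm]
  refine (Real.volume_le_diam _).trans (Metric.ediam_le fun x hx y hy => ?_)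
  rw [edist_dist]
  refine ENNReal.ofReal_le_ofReal ?_
  have := abs_coord_sub_le N hN n x y (hx.1.trans hy.1.symm)
  rwa [coord_coe, coord_coe, Int.fract_eq_self.2 hx.2, Int.fract_eq_self.2 hy.2] at this

/-! ### The measures of maximal entropy -/

/-- The measure that the conjugacy of a left-infinite word carries to Lebesgue measure. -/
noncomputable def wordMeasure (σ : LeftWord) : ProbabilityMeasure X :=
  ⟨(volume : Measure X).map (circleConj σ).symm,
    Measure.isProbabilityMeasure_map (circleConj σ).symm.continuous.measurable.aemeasurable⟩

theorem measurePreserving_circleConj_symm (σ : LeftWord) :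
    MeasurePreserving (circleConj σ).symm volume (wordMeasure σ : Measure X) :=
  ⟨(circleConj σ).symm.continuous.measurable, rfl⟩

theorem measurePreserving_circleConj (σ : LeftWord) :
    MeasurePreserving (circleConj σ) (wordMeasure σ : Measure X) volume := by
  refine ⟨(circleConj σ).continuous.measurable, ?_⟩
  rw [← (measurePreserving_circleConj_symm σ).map_eq, Measure.map_map
    (circleConj σ).continuous.measurable (circleConj σ).symm.continuous.measurable]
  simp

/-- The base `N` digits are pulled back through the conjugacy. Uniform continuity of its inverse
makes the pulled back partition generating, and atoms keep their mass. -/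
theorem isEquilibriumState_iff_of_conj {N : ℕ} (hN : 1 < N) (σ : LeftWord) {g : X → X}
    (hg : ∀ z, circleConj σ (g z) = N • circleConj σ z) (μ : ProbabilityMeasure X) :
    IsEquilibriumState g 0 μ ↔ μ = wordMeasure σ := by
  have hN0 : 0 < N := by omega
  have hN' : (1 : ℝ) < N := by exact_mod_cast hN
  have hjoin : ∀ n, joinPartition g (digit N hN0 ∘ circleConj σ) n =
      joinPartition (fun y : X => N • y) (digit N hN0) n ∘ circleConj σ := by
    intro n
    funext z j
    exact congrArg (digit N hN0)
      (Function.Semiconj.iterate_right (f := circleConj σ) (gb := fun y : X => N • y) hg j z)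
  refine isEquilibriumState_iff_of_generating (α := digit N hN0 ∘ circleConj σ)
    ((measurable_digit N hN0).comp (circleConj σ).continuous.measurable) ?_ ?_ ?_ μ
  · intro δ hδ
    have huc := CompactSpace.uniformContinuous_of_continuous (circleConj σ).symm.continuous
    obtain ⟨η, hη, h⟩ := Metric.uniformContinuous_iff.1 huc δ hδ
    obtain ⟨r, hr⟩ := exists_pow_lt_of_lt_one hη (inv_lt_one_of_one_lt₀ hN')
    refine ⟨r, fun x y hxy => ?_⟩
    rw [hjoin] at hxy
    have h1 := abs_coord_sub_le N hN0 r _ _ hxy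
    have h2 := (dist_le_abs_coord_sub _ _).trans h1
    rw [one_div, ← inv_pow] at h2
    simpa using h (h2.trans_lt hr)
  · have e : g = (circleConj σ).symm ∘ (fun y : X => N • y) ∘ circleConj σ := by
      funext z
      simp [← hg]
    rw [e]
    exact (measurePreserving_circleConj_symm σ).comp
      ((AddCircle.ergodic_nsmul hN).toMeasurePreserving.comp (measurePreserving_circleConj σ))
  · intro n a
    rw [hjoin, preimage_comp, (measurePreserving_circleConj σ).measureReal_preimage
      (measurable_joinPartition (continuous_nsmul N).measurable (measurable_digit N hN0) n
        (measurableSet_singleton a)).nullMeasurableSet]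
    exact volume_atom_le N hN0 n a

/-- The conjugacy is the distribution function of its measure, so it can be recovered from the
measure. -/
theorem wordMeasure_coord_lt (σ : LeftWord) {t : ℝ} (h1 : t ≤ 1) :
    (wordMeasure σ : Measure X) {z | coord z < t} = ENNReal.ofReal (conj σ t) := by
  have hm : MeasurableSet {z : X | coord z < t} := measurable_coord measurableSet_Iio
  rw [← (measurePreserving_circleConj_symm σ).measure_preimage hm.nullMeasurableSet,
    volume_circle_eq ((circleConj σ).symm.continuous.measurable hm)]
  have ht1 : conj σ t ≤ 1 := by
    have := conj_monotone σ h1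
    have e := conj_int σ 1
    rw [Int.cast_one] at e
    rwa [e] at this
  have e : ((↑) : ℝ → X) ⁻¹' ((circleConj σ).symm ⁻¹' {z | coord z < t}) ∩ Ico 0 1 =
      Ico 0 (conj σ t) := by
    ext y
    simp only [mem_inter_iff, mem_preimage, mem_ofPred_eq, circleConj_symm_coe, coord_coe, mem_Ico]
    have key : 0 ≤ y → y < 1 → Int.fract ((conjIso σ).symm y) = (conjIso σ).symm y := by
      intro hy0 hy1
      rw [Int.fract_eq_self]
      constructor
      · rw [OrderIso.le_symm_apply, conjIso_apply]
        have := conj_int σ 0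
        rw [Int.cast_zero] at this
        rwa [this]
      · rw [OrderIso.symm_apply_lt, conjIso_apply]
        have := conj_int σ 1
        rw [Int.cast_one] at this
        rwa [this]
    constructor
    · rintro ⟨h, hy0, hy1⟩
      rw [key hy0 hy1, OrderIso.symm_apply_lt] at h
      exact ⟨hy0, h⟩
    · rintro ⟨hy0, h⟩
      have hy1 := h.trans_le ht1
      refine ⟨?_, hy0, hy1⟩
      rw [key hy0 hy1, OrderIso.symm_apply_lt]
      exact h
  rw [e, Real.volume_Ico, sub_zero]

theorem wordMeasure_injective : Function.Injective wordMeasure := by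
  intro σ τ h
  refine conj_injective (funext fun x => ?_)
  have hfract : conj σ (Int.fract x) = conj τ (Int.fract x) := by
    have h1 := wordMeasure_coord_lt σ (Int.fract_lt_one x).le
    have h2 := wordMeasure_coord_lt τ (Int.fract_lt_one x).le
    have hnn : ∀ ρ, 0 ≤ conj ρ (Int.fract x) := fun ρ => by
      have := conj_monotone ρ (Int.fract_nonneg x)
      have e := conj_int ρ 0
      rw [Int.cast_zero] at e
      rwa [e] at this
    rw [h, h2] at h1
    exact ((ENNReal.ofReal_eq_ofReal_iff (hnn _) (hnn _)).1 h1).symm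
  rw [← Int.fract_add_floor x, conj_add_int, conj_add_int, hfract]

/-! ### The Vaserstein distance -/

section Vaserstein

set_option linter.unusedSectionVars false

theorem dStar_nonneg {Y : Type*} [PseudoMetricSpace Y] {Δ : ℝ} (α : ℝ) (hΔ : 0 < Δ) (x y : Y) :
    0 ≤ dStar Δ α x y :=
  le_min zero_le_one (mul_nonneg hΔ.le (Real.rpow_nonneg dist_nonneg _))

theorem dStar_comm {Y : Type*} [PseudoMetricSpace Y] (Δ α : ℝ) (x y : Y) :
    dStar Δ α x y = dStar Δ α y x := by
  rw [dStar, dStar, dist_comm]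

/-- For `α ≤ 1` the power `t ^ α` is subadditive, and truncation at one preserves the triangle
inequality. -/
theorem dStar_triangle {Y : Type*} [PseudoMetricSpace Y] {Δ α : ℝ} (hΔ : 0 < Δ) (hα : 0 < α)
    (hα1 : α ≤ 1) (x y z : Y) : dStar Δ α x z ≤ dStar Δ α x y + dStar Δ α y z := by
  have h0 : dist x z ^ α ≤ dist x y ^ α + dist y z ^ α := by
    refine (Real.rpow_le_rpow dist_nonneg (dist_triangle x y z) hα.le).trans ?_
    exact_mod_cast NNReal.rpow_add_le_add_rpow (nndist x y) (nndist y z) hα.le hα1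
  have h1 : Δ * dist x z ^ α ≤ Δ * dist x y ^ α + Δ * dist y z ^ α := by
    rw [← mul_add]; exact mul_le_mul_of_nonneg_left h0 hΔ.le
  have n1 := dStar_nonneg α hΔ x y
  have n2 := dStar_nonneg α hΔ y z
  unfold dStar at *
  rcases le_total 1 (Δ * dist x y ^ α) with h | h
  · rw [min_eq_left h]
    exact (min_le_left _ _).trans (by linarith)
  rcases le_total 1 (Δ * dist y z ^ α) with h' | h'
  · rw [min_eq_left h']
    exact (min_le_left _ _).trans (by linarith)
  rw [min_eq_right h, min_eq_right h']
  exact (min_le_right _ _).trans h1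

variable {Y : Type*} [MetricSpace Y] [MeasurableSpace Y] [BorelSpace Y]
  [SecondCountableTopology Y] {Δ α : ℝ}

theorem continuous_dStar (hα : 0 < α) : Continuous fun z : Y × Y => dStar Δ α z.1 z.2 :=
  continuous_const.min (continuous_const.mul
    ((continuous_fst.dist continuous_snd).rpow_const fun _ => Or.inr hα.le))

theorem integrable_dStar (hΔ : 0 < Δ) (hα : 0 < α) (P : Measure (Y × Y)) [IsFiniteMeasure P] :
    Integrable (fun z : Y × Y => dStar Δ α z.1 z.2) P := by
  refine Integrable.of_bound (continuous_dStar hα).measurable.aestronglyMeasurable 1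
    (Eventually.of_forall fun z => ?_)
  rw [Real.norm_eq_abs, abs_of_nonneg (dStar_nonneg α hΔ _ _)]
  exact min_le_left _ _

theorem bddBelow_vaserstein (hΔ : 0 < Δ) (μ ν : ProbabilityMeasure Y) :
    BddBelow {r : ℝ | ∃ P : ProbabilityMeasure (Y × Y),
      (P : Measure (Y × Y)).map Prod.fst = (μ : Measure Y) ∧
      (P : Measure (Y × Y)).map Prod.snd = (ν : Measure Y) ∧
      r = ∫ z, dStar Δ α z.1 z.2 ∂(P : Measure (Y × Y))} := by
  refine ⟨0, ?_⟩
  rintro r ⟨P, -, -, rfl⟩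
  exact integral_nonneg fun z => dStar_nonneg α hΔ _ _

theorem vaserstein_le (hΔ : 0 < Δ) {μ ν : ProbabilityMeasure Y} (P : ProbabilityMeasure (Y × Y))
    (h1 : (P : Measure (Y × Y)).map Prod.fst = (μ : Measure Y))
    (h2 : (P : Measure (Y × Y)).map Prod.snd = (ν : Measure Y)) :
    vaserstein Δ α μ ν ≤ ∫ z, dStar Δ α z.1 z.2 ∂(P : Measure (Y × Y)) :=
  csInf_le (bddBelow_vaserstein hΔ μ ν) ⟨P, h1, h2, rfl⟩

theorem vaserstein_nonneg (hΔ : 0 < Δ) (μ ν : ProbabilityMeasure Y) :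
    0 ≤ vaserstein Δ α μ ν := by
  refine Real.sInf_nonneg ?_
  rintro r ⟨P, -, -, rfl⟩
  exact integral_nonneg fun z => dStar_nonneg α hΔ _ _

theorem exists_coupling_lt (μ ν : ProbabilityMeasure Y) {ε : ℝ} (hε : 0 < ε) :
    ∃ P : ProbabilityMeasure (Y × Y), (P : Measure (Y × Y)).map Prod.fst = (μ : Measure Y) ∧
      (P : Measure (Y × Y)).map Prod.snd = (ν : Measure Y) ∧
      ∫ z, dStar Δ α z.1 z.2 ∂(P : Measure (Y × Y)) < vaserstein Δ α μ ν + ε := by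
  have hne : {r : ℝ | ∃ P : ProbabilityMeasure (Y × Y),
      (P : Measure (Y × Y)).map Prod.fst = (μ : Measure Y) ∧
      (P : Measure (Y × Y)).map Prod.snd = (ν : Measure Y) ∧
      r = ∫ z, dStar Δ α z.1 z.2 ∂(P : Measure (Y × Y))}.Nonempty := by
    refine ⟨_, ⟨(μ : Measure Y).prod ν, inferInstance⟩, ?_, ?_, rfl⟩
    · exact measurePreserving_fst.map_eq
    · exact measurePreserving_snd.map_eq
  obtain ⟨r, ⟨P, h1, h2, rfl⟩, hr⟩ := exists_lt_of_csInf_lt hne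
    (lt_add_of_pos_right (vaserstein Δ α μ ν) hε)
  exact ⟨P, h1, h2, hr⟩

theorem vaserstein_comm_le (hΔ : 0 < Δ) (hα : 0 < α) (μ ν : ProbabilityMeasure Y) :
    vaserstein Δ α μ ν ≤ vaserstein Δ α ν μ := by
  refine le_of_forall_pos_le_add fun ε hε => ?_
  obtain ⟨P, h1, h2, h3⟩ := exists_coupling_lt (Δ := Δ) (α := α) ν μ hε
  refine (vaserstein_le hΔ (P.map measurable_swap.aemeasurable) ?_ ?_).trans (le_trans ?_ h3.le)
  · rw [ProbabilityMeasure.toMeasure_map, Measure.map_map measurable_fst measurable_swap]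
    exact h2
  · rw [ProbabilityMeasure.toMeasure_map, Measure.map_map measurable_snd measurable_swap]
    exact h1
  · rw [ProbabilityMeasure.toMeasure_map, integral_map measurable_swap.aemeasurable
      (continuous_dStar hα).measurable.aestronglyMeasurable]
    simp only [Prod.fst_swap, Prod.snd_swap]
    exact le_of_eq (integral_congr_ae (Eventually.of_forall fun z => dStar_comm _ _ _ _))

theorem vaserstein_comm (hΔ : 0 < Δ) (hα : 0 < α) (μ ν : ProbabilityMeasure Y) :
    vaserstein Δ α μ ν = vaserstein Δ α ν μ :=
  le_antisymm (vaserstein_comm_le hΔ hα μ ν) (vaserstein_comm_le hΔ hα ν μ)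

open ProbabilityTheory in
/-- The gluing of two couplings with a common marginal. -/
theorem exists_gluing {Y : Type*} [MeasurableSpace Y] [StandardBorelSpace Y] [Nonempty Y]
    (P Q : Measure (Y × Y)) [IsProbabilityMeasure P] [IsProbabilityMeasure Q]
    (h : P.map Prod.snd = Q.map Prod.fst) :
    ∃ R : Measure ((Y × Y) × Y), IsProbabilityMeasure R ∧ R.map Prod.fst = P ∧
      R.map (fun w => (w.1.2, w.2)) = Q := by
  -- Given a pair drawn from `P`, the third coordinate is drawn from the conditional law of `Q`
  -- given the second coordinate.
  refine ⟨P ⊗ₘ (Kernel.prodMkLeft Y Q.condKernel), inferInstance,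
    Measure.fst_compProd P _, ?_⟩
  have hf : Measurable fun w : (Y × Y) × Y => (w.1.2, w.2) := by fun_prop
  ext s hs
  rw [Measure.map_apply hf hs, Measure.compProd_apply (hf hs)]
  conv_rhs => rw [← Q.disintegrate Q.condKernel, Measure.compProd_apply hs, Measure.fst, ← h,
    lintegral_map (Kernel.measurable_kernel_prodMk_left hs) measurable_snd]
  rfl

theorem vaserstein_triangle [StandardBorelSpace Y] (hΔ : 0 < Δ) (hα : 0 < α) (hα1 : α ≤ 1)
    (μ ν ρ : ProbabilityMeasure Y) :
    vaserstein Δ α μ ρ ≤ vaserstein Δ α μ ν + vaserstein Δ α ν ρ := by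
  have : Nonempty Y := nonempty_of_isProbabilityMeasure (μ : Measure Y)
  refine le_of_forall_pos_le_add fun ε hε => ?_
  obtain ⟨P, hP1, hP2, hP3⟩ := exists_coupling_lt (Δ := Δ) (α := α) μ ν (half_pos hε)
  obtain ⟨Q, hQ1, hQ2, hQ3⟩ := exists_coupling_lt (Δ := Δ) (α := α) ν ρ (half_pos hε)
  obtain ⟨M, hM, hRP, hRQ⟩ := exists_gluing (P : Measure (Y × Y)) (Q : Measure (Y × Y))
    (hP2.trans hQ1.symm)
  have m12 : Measurable (Prod.fst : (Y × Y) × Y → Y × Y) := measurable_fst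
  have m23 : Measurable fun w : (Y × Y) × Y => (w.1.2, w.2) := by fun_prop
  have m13 : Measurable fun w : (Y × Y) × Y => (w.1.1, w.2) := by fun_prop
  have i12 := (integrable_dStar (Y := Y) hΔ hα (M.map Prod.fst)).comp_measurable m12
  have hfin : IsFiniteMeasure (M.map fun w : (Y × Y) × Y => (w.1.2, w.2)) := by
    rw [hRQ]; infer_instance
  have i23 := (integrable_dStar (Y := Y) hΔ hα
    (M.map fun w : (Y × Y) × Y => (w.1.2, w.2))).comp_measurable m23
  refine (vaserstein_le hΔ ⟨M.map fun w => (w.1.1, w.2),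
    Measure.isProbabilityMeasure_map m13.aemeasurable⟩ ?_ ?_).trans ?_
  · rw [ProbabilityMeasure.coe_mk, Measure.map_map measurable_fst m13, ← hP1, ← hRP,
      Measure.map_map measurable_fst m12]
    rfl
  · rw [ProbabilityMeasure.coe_mk, Measure.map_map measurable_snd m13, ← hQ2, ← hRQ,
      Measure.map_map measurable_snd m23]
    rfl
  · have e1 : (∫ z, dStar Δ α z.1 z.2 ∂(P : Measure (Y × Y))) =
        (∫ w, dStar Δ α w.1.1 w.1.2 ∂M) := by
      rw [← hRP, integral_map m12.aemeasurable
        (continuous_dStar hα).measurable.aestronglyMeasurable]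
    have e2 : (∫ z, dStar Δ α z.1 z.2 ∂(Q : Measure (Y × Y))) =
        (∫ w, dStar Δ α w.1.2 w.2 ∂M) := by
      rw [← hRQ, integral_map m23.aemeasurable
        (continuous_dStar hα).measurable.aestronglyMeasurable]
    rw [ProbabilityMeasure.coe_mk, integral_map m13.aemeasurable
      (continuous_dStar hα).measurable.aestronglyMeasurable]
    calc (∫ w, dStar Δ α w.1.1 w.2 ∂M)
        ≤ (∫ w, (dStar Δ α w.1.1 w.1.2 + dStar Δ α w.1.2 w.2) ∂M) := by
          refine integral_mono_of_nonneg (Eventually.of_forall fun w => dStar_nonneg α hΔ _ _)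
            (i12.add i23) (Eventually.of_forall fun w => dStar_triangle hΔ hα hα1 _ _ _)
      _ = (∫ w, dStar Δ α w.1.1 w.1.2 ∂M) + (∫ w, dStar Δ α w.1.2 w.2 ∂M) :=
          integral_add i12 i23
      _ ≤ _ := by linarith

/-- Under a coupling of small cost, Markov's inequality makes pairs at distance at least `ε`
improbable, so the Lévy–Prokhorov distance vanishes. -/
theorem eq_of_vaserstein_eq_zero (hΔ : 0 < Δ) (hα : 0 < α) {μ ν : ProbabilityMeasure Y}
    (h : vaserstein Δ α μ ν = 0) : μ = ν := by
  refine congrArg LevyProkhorov.toMeasure (a₁ := .ofMeasure μ) (a₂ := .ofMeasure ν)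
    (eq_of_dist_eq_zero ?_)
  rw [LevyProkhorov.dist_probabilityMeasure_def]
  refine le_antisymm (levyProkhorovDist_le_of_forall_le _ _ le_rfl fun ε B hε hB => ?_)
    ENNReal.toReal_nonneg
  -- This is the least cost of moving mass a distance of at least `ε`; a coupling of cost below `c *
  -- ε` does so with probability below `ε`.
  set c := min 1 (Δ * ε ^ α) with hc
  have hc0 : 0 < c := lt_min one_pos (mul_pos hΔ (Real.rpow_pos_of_pos hε _))
  obtain ⟨P, h1, h2, h3⟩ := exists_coupling_lt (Δ := Δ) (α := α) μ ν (mul_pos hc0 hε)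
  rw [h, zero_add] at h3
  have hmarkov := mul_meas_ge_le_integral_of_nonneg (μ := (P : Measure (Y × Y)))
    (Eventually.of_forall fun z : Y × Y => dStar_nonneg α hΔ z.1 z.2)
    (integrable_dStar hΔ hα _) c
  have hlt := lt_of_mul_lt_mul_left (hmarkov.trans_lt h3) hc0.le
  have hthick : MeasurableSet (Metric.thickening ε B) := Metric.isOpen_thickening.measurableSet
  calc (μ : Measure Y) B = (P : Measure (Y × Y)) (Prod.fst ⁻¹' B) := by
        rw [← h1, Measure.map_apply measurable_fst hB]
    _ ≤ (P : Measure (Y × Y)) (Prod.snd ⁻¹' (Metric.thickening ε B) ∪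
          {z | c ≤ dStar Δ α z.1 z.2}) := by
        refine measure_mono fun z hz => ?_
        rcases lt_or_ge (dist z.2 z.1) ε with hd | hd
        · exact Or.inl (Metric.mem_thickening_iff.2 ⟨z.1, hz, hd⟩)
        · refine Or.inr (min_le_min_left _ (mul_le_mul_of_nonneg_left
            (Real.rpow_le_rpow hε.le ?_ hα.le) hΔ.le))
          rwa [dist_comm]
    _ ≤ _ := measure_union_le _ _
    _ ≤ (ν : Measure Y) (Metric.thickening ε B) + ENNReal.ofReal ε := by
        rw [← h2, Measure.map_apply measurable_snd hthick]
        gcongr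
        rw [← ENNReal.ofReal_toReal (measure_ne_top (P : Measure (Y × Y)) _)]
        exact ENNReal.ofReal_le_ofReal hlt.le

end Vaserstein

/-! ### The minimal local expansion -/

theorem exists_coe_dist_eq (z w : X) : ∃ a b : ℝ, (a : X) = z ∧ (b : X) = w ∧ dist z w = |a - b| := by
  induction z using QuotientAddGroup.induction_on with | _ a =>
  induction w using QuotientAddGroup.induction_on with | _ b =>
  refine ⟨a, b + round (a - b), rfl, (coe_eq_coe_iff.2 ⟨_, rfl⟩).symm, ?_⟩
  rw [dist_eq_norm, ← AddCircle.coe_sub, UnitAddCircle.norm_eq, sub_add_eq_sub_sub]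

theorem dist_coe_eq {a b : ℝ} (h : |a - b| ≤ 1 / 2) : dist (a : X) (b : X) = |a - b| := by
  rw [dist_eq_norm, ← AddCircle.coe_sub, AddCircle.norm_coe_eq_abs_iff _ one_ne_zero]
  simpa using h

section Kappa

variable {n : ℕ} {F : ℝ → ℝ} {g : X → X}

theorem le_kappa (hF : IsLift n F) (hg : ∀ x : ℝ, g (x : X) = (F x : X)) :
    ENNReal.ofReal ((4 / 3) ^ n) ≤ kappa g := by
  have hpos : (0 : ℝ) < 12 ^ n := by positivity
  -- At this scale the images under the lift differ by at most `1/2`, where circle distance equals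
  -- distance on the line.
  refine le_iSup₂_of_le (1 / (2 * 12 ^ n)) (by positivity) ?_
  refine le_iInf fun z => le_iInf fun w => le_iInf fun h0 => le_iInf fun h1 => ?_
  obtain ⟨a, b, rfl, rfl, hd⟩ := exists_coe_dist_eq z w
  have hF1 := hF.slopes.abs_le a b (by positivity)
  have hF2 := hF.slopes.abs_ge a b
  rw [hd] at h1
  have h2 : |F a - F b| ≤ 1 / 2 := by
    refine hF1.trans ?_
    rw [lt_div_iff₀ (by positivity)] at h1
    linarith
  rw [ENNReal.le_div_iff_mul_le (Or.inl (by simpa using h0.ne')) (Or.inl (edist_ne_top _ _)),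
    edist_dist, edist_dist, ← ENNReal.ofReal_mul (by positivity), hg, hg, dist_coe_eq h2, hd]
  exact ENNReal.ofReal_le_ofReal hF2

/-- The upper bound serves only to make `κ` finite, so that `1/κ` is positive. -/
theorem kappa_le (hF : IsLift n F) (hg : ∀ x : ℝ, g (x : X) = (F x : X)) :
    kappa g ≤ ENNReal.ofReal (12 ^ n) := by
  refine iSup₂_le fun ε hε => ?_
  set t := min (ε / 2) (1 / 2) with ht
  have ht0 : 0 < t := lt_min (half_pos hε) one_half_pos
  have hd : dist ((t : ℝ) : X) ((0 : ℝ) : X) = t := by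
    rw [dist_coe_eq] <;> rw [sub_zero, abs_of_pos ht0]
    exact min_le_right _ _
  refine iInf₂_le_of_le ((t : ℝ) : X) ((0 : ℝ) : X) (iInf₂_le_of_le (by rwa [hd]) ?_ ?_)
  · rw [hd]
    exact (min_le_left _ _).trans_lt (half_lt_self hε)
  · have hF1 := hF.slopes.abs_le t 0 (by positivity)
    refine ENNReal.div_le_of_le_mul ?_
    rw [edist_dist, edist_dist, ← ENNReal.ofReal_mul (by positivity), hd, hg, hg]
    refine ENNReal.ofReal_le_ofReal ((dist_coe_le _ _).trans (hF1.trans ?_))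
    rw [sub_zero, abs_of_pos ht0]

theorem toReal_one_div_kappa_pos (hF : IsLift n F) (hg : ∀ x : ℝ, g (x : X) = (F x : X)) :
    0 < (1 / kappa g).toReal := by
  have h1 := le_kappa hF hg
  have h2 := kappa_le hF hg
  rw [one_div]
  refine ENNReal.toReal_pos (ENNReal.inv_ne_zero.2 (h2.trans_lt ENNReal.ofReal_lt_top).ne)
    (ENNReal.inv_ne_top.2 (lt_of_lt_of_le ?_ h1).ne')
  rw [ENNReal.ofReal_pos]
  positivity

theorem toReal_one_div_kappa_le (hF : IsLift n F) (hg : ∀ x : ℝ, g (x : X) = (F x : X)) :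
    (1 / kappa g).toReal ≤ (3 / 4) ^ n := by
  refine ENNReal.toReal_le_of_le_ofReal (by positivity) ?_
  rw [one_div, ENNReal.inv_le_iff_inv_le, ← ENNReal.ofReal_inv_of_pos (by positivity), ← inv_pow]
  norm_num only
  exact le_kappa hF hg

end Kappa

/-! ### The elements of the semigroup -/

theorem truncation_congr {σ τ : LeftWord} {n : ℕ} (h : ∀ k ≤ n, σ k = τ k) :
    truncation σ n = truncation τ n := by
  induction n with
  | zero => rw [truncation, truncation, h 0 le_rfl]
  | succ n ih =>
    rw [truncation, truncation, ih fun k hk => h k (hk.trans n.le_succ), h _ le_rfl]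

theorem truncation_potential (σ : LeftWord) (n : ℕ) : (truncation σ n).1.potential = 0 := by
  induction n with
  | zero => rfl
  | succ n ih =>
    change (truncation σ n).1.potential + (0 : X → ℝ) ∘ (truncation σ n).1.map = 0
    rw [ih, zero_add]
    rfl

theorem exists_truncation_mul (σ τ : LeftWord) (n m : ℕ) :
    ∃ ρ : LeftWord, truncation ρ (n + (m + 1)) = truncation σ n * truncation τ m := by
  -- `truncation τ m` has `m + 1` letters. As the right factor it acts first, so its letters occupy
  -- the lowest positions.
  refine ⟨fun k => if k ≤ m then τ k else σ (k - (m + 1)), ?_⟩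
  induction n with
  | zero =>
    rw [zero_add, truncation, truncation]
    congr 1
    · simp
    · exact truncation_congr fun k hk => by simp [hk]
  | succ n ih =>
    rw [show n + 1 + (m + 1) = (n + (m + 1)) + 1 by ring, truncation, ih, truncation, mul_assoc]
    congr 2
    have h1 : ¬ n + (m + 1) + 1 ≤ m := by omega
    have h2 : n + (m + 1) + 1 - (m + 1) = n + 1 := by omega
    rw [if_neg h1, h2]

/-- Repeating a finite word periodically makes its product conjugate to a multiplication, hence the
periodicity in the conclusion. -/
theorem exists_eq_truncation (p : G) :
    ∃ (σ : LeftWord) (n : ℕ), p = truncation σ n ∧ ∀ k, σ (k + (n + 1)) = σ k := by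
  have h : ∃ (σ : LeftWord) (n : ℕ), p = truncation σ n := by
    obtain ⟨p, hp⟩ := p
    induction hp using Subsemigroup.closure_induction with
    | mem x hx =>
      obtain ⟨i, rfl⟩ := hx
      exact ⟨fun _ => i, 0, rfl⟩
    | mul x y hx hy ihx ihy =>
      obtain ⟨σ, n, hσ⟩ := ihx
      obtain ⟨τ, m, hτ⟩ := ihy
      obtain ⟨ρ, hρ⟩ := exists_truncation_mul σ τ n m
      exact ⟨ρ, n + (m + 1), by rw [hρ, ← hσ, ← hτ]; rfl⟩
  obtain ⟨σ, n, rfl⟩ := h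
  refine ⟨fun k => σ (k % (n + 1)), n, truncation_congr fun k hk => ?_, fun k => ?_⟩
  · rw [Nat.mod_eq_of_lt (Nat.lt_succ_of_le hk)]
  · simp

/-- Every element of `𝔾` has the measure of a left-infinite word as its equilibrium state. -/
theorem isEquilibriumState_truncation_iff (σ : LeftWord) (n : ℕ)
    (hσ : ∀ k, σ (k + (n + 1)) = σ k) (μ : ProbabilityMeasure X) :
    IsEquilibriumState (truncation σ n).1.map (truncation σ n).1.potential μ ↔
      μ = wordMeasure σ := by
  rw [truncation_potential]
  exact isEquilibriumState_iff_of_conj (Nat.one_lt_pow n.succ_ne_zero (by norm_num)) σ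
    (circleConj_truncation σ n hσ) μ

theorem equilibriumState_truncation (σ : LeftWord) (n : ℕ) (hσ : ∀ k, σ (k + (n + 1)) = σ k) :
    equilibriumState (truncation σ n) = wordMeasure σ :=
  (isEquilibriumState_truncation_iff σ n hσ _).1
    (Classical.epsilon_spec ⟨_, (isEquilibriumState_truncation_iff σ n hσ _).2 rfl⟩)

theorem existsUnique_isEquilibriumState (p : G) :
    ∃! μ : ProbabilityMeasure X, IsEquilibriumState p.1.map p.1.potential μ := by
  obtain ⟨σ, n, rfl, hσ⟩ := exists_eq_truncation p
  exact ⟨_, (isEquilibriumState_truncation_iff σ n hσ _).2 rfl,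
    fun μ hμ => (isEquilibriumState_truncation_iff σ n hσ _).1 hμ⟩

/-- The reciprocal of the minimal local expansion. -/
noncomputable def invKappa (p : G) : ℝ := (1 / kappa p.1.map).toReal

theorem invKappa_pos (p : G) : 0 < invKappa p := by
  obtain ⟨σ, n, rfl, -⟩ := exists_eq_truncation p
  exact toReal_one_div_kappa_pos (isLift_liftIter σ (n + 1)) (truncation_map_coe σ n)

theorem invKappa_truncation_le (σ : LeftWord) (n : ℕ) :
    invKappa (truncation σ n) ≤ (3 / 4) ^ n :=
  (toReal_one_div_kappa_le (isLift_liftIter σ (n + 1)) (truncation_map_coe σ n)).trans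
    (pow_le_pow_of_le_one (by norm_num) (by norm_num) n.le_succ)

/-! ### Freeness -/

/-- The lift of the product of the generators whose indices are the letters of a word. -/
noncomputable def listLift (l : List (Fin 2)) : ℝ → ℝ :=
  l.foldr (fun i F => genLift i ∘ F) id

theorem isLift_listLift (l : List (Fin 2)) : IsLift l.length (listLift l) := by
  induction l with
  | nil => exact IsLift.id
  | cons i l ih => exact ih.genLift_comp i

theorem listLift_concat (l : List (Fin 2)) (i : Fin 2) :
    listLift (l ++ [i]) = listLift l ∘ genLift i := by
  induction l with
  | nil => rfl
  | cons j l ih => exact congrArg (genLift j ∘ ·) ih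

/-- The value at `1` is `4` to the power of the length. With lengths equal, both lifts take the same
value at the break points of the letters applied first; monotonicity identifies these points and
hence the letters, and surjectivity of the generator cancels them. -/
theorem listLift_injective : Function.Injective listLift := by
  intro l l' h
  have hlen : l.length = l'.length := by
    have h1 := (isLift_listLift l).int 1
    have h2 := (isLift_listLift l').int 1
    rw [h, h2] at h1
    simp only [Int.cast_one, mul_one] at h1
    exact (pow_right_injective₀ (by norm_num : (0 : ℝ) < 4) (by norm_num) h1).symm
  induction l using List.reverseRecOn generalizing l' with
  | nil => exact (List.length_eq_zero_iff.1 hlen.symm).symm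
  | append_singleton l i ih =>
    rcases List.eq_nil_or_concat l' with rfl | ⟨l', j, rfl⟩
    · simp at hlen
    have hlen' : l.length = l'.length := by simpa using hlen
    rw [List.concat_eq_append, listLift_concat, listLift_concat] at h
    have e1 := congrFun h (firstBreak i)
    have e2 : (listLift l ∘ genLift i) (firstBreak i) = (listLift l' ∘ genLift j) (firstBreak j) := by
      have a1 := (isLift_listLift l).int 1
      have a2 := (isLift_listLift l').int 1
      rw [Int.cast_one] at a1 a2
      rw [Function.comp_apply, Function.comp_apply, genLift_firstBreak, genLift_firstBreak, a1, a2,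
        hlen']
    have hmono : StrictMono (listLift l' ∘ genLift j) :=
      (isLift_listLift l').strictMono.comp ((hasSlopesIn_genLift j).strictMono (by norm_num))
    have hij : i = j := firstBreak_injective (hmono.injective (e1.symm.trans e2))
    subst hij
    have hsurj := (hasSlopesIn_genLift i).surjective (by norm_num)
    rw [ih (hsurj.injective_comp_right h) hlen', List.concat_eq_append]

/-- Two continuous functions that vanish at `0` and lift the same circle map agree. -/
theorem eq_of_coe_eq {F F' : ℝ → ℝ} (hF : Continuous F) (hF' : Continuous F') (h0 : F 0 = F' 0)
    (h : ∀ x, (F x : X) = (F' x : X)) : F = F' :=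
  (AddCircle.isCoveringMap_coe (1 : ℝ)).eq_of_comp_eq hF hF' (funext h) 0 h0

theorem lift_gen_coe (w : FreeSemigroup (Fin 2)) (x : ℝ) :
    (FreeSemigroup.lift gen w) (x : X) = (listLift (w.head :: w.tail) x : X) := by
  induction w using FreeSemigroup.recOnMul generalizing x with
  | ih1 i => exact gen_coe i x
  | ih2 i w _ ih =>
    rw [map_mul, FreeSemigroup.lift_of]
    change gen i (FreeSemigroup.lift gen w (x : X)) = _
    rw [ih, gen_coe]
    rfl

theorem lift_gen_injective : Function.Injective (FreeSemigroup.lift gen) := by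
  intro w w' h
  have hl : listLift (w.head :: w.tail) = listLift (w'.head :: w'.tail) :=
    eq_of_coe_eq (isLift_listLift _).continuous (isLift_listLift _).continuous
      ((isLift_listLift _).zero.trans (isLift_listLift _).zero.symm) fun x => by
        rw [← lift_gen_coe, ← lift_gen_coe, h]
  have := List.cons.inj (listLift_injective hl)
  exact FreeSemigroup.ext this.1 this.2

theorem exists_mulEquiv_mapSemigroup : ∃ e : FreeSemigroup (Fin 2) ≃* mapSemigroup,
    ∀ i : Fin 2, ((e (FreeSemigroup.of i) : mapSemigroup) : Function.End X) = gen i := by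
  have hgen : ∀ i, gen i ∈ mapSemigroup := fun i => by
    refine Subsemigroup.subset_closure ?_
    fin_cases i
    exacts [Or.inl rfl, Or.inr rfl]
  let f : FreeSemigroup (Fin 2) →ₙ* mapSemigroup := FreeSemigroup.lift fun i => ⟨gen i, hgen i⟩
  have hf : ∀ w, (f w : Function.End X) = FreeSemigroup.lift gen w := by
    have : (MulMemClass.subtype mapSemigroup).comp f = FreeSemigroup.lift gen :=
      FreeSemigroup.hom_ext (funext fun i => rfl)
    exact fun w => DFunLike.congr_fun this w
  have hinj : Function.Injective f := fun w w' h =>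
    lift_gen_injective (by rw [← hf, ← hf, h])
  have hsurj : Function.Surjective f := by
    rintro ⟨g, hg⟩
    induction hg using Subsemigroup.closure_induction with
    | mem x hx =>
      rcases hx with rfl | rfl
      · exact ⟨FreeSemigroup.of 0, rfl⟩
      · exact ⟨FreeSemigroup.of 1, rfl⟩
    | mul x y hx hy ihx ihy =>
      obtain ⟨a, ha⟩ := ihx
      obtain ⟨b, hb⟩ := ihy
      exact ⟨a * b, by rw [map_mul, ha, hb]; rfl⟩
  exact ⟨MulEquiv.ofBijective f ⟨hinj, hsurj⟩, fun i => rfl⟩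

/-! ### The metric on the semigroup -/

section Boundary

variable {Δ α : ℝ}

/-- The coupling is the image of Lebesgue measure under the pair of inverse conjugacies, which are
uniformly close. -/
theorem vaserstein_wordMeasure_le (hΔ : 0 < Δ) (hα : 0 < α) {σ τ : LeftWord} {n : ℕ}
    (h : ∀ k < n, σ k = τ k) :
    vaserstein Δ α (wordMeasure σ) (wordMeasure τ) ≤ Δ * (2 * (3 / 4) ^ n) ^ α := by
  have hs := (circleConj σ).symm.continuous.measurable
  have ht := (circleConj τ).symm.continuous.measurable
  have hst := hs.prodMk ht
  refine (vaserstein_le hΔ ⟨(volume : Measure X).map fun z =>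
    ((circleConj σ).symm z, (circleConj τ).symm z),
    Measure.isProbabilityMeasure_map hst.aemeasurable⟩ ?_ ?_).trans ?_
  · rw [ProbabilityMeasure.coe_mk, Measure.map_map measurable_fst hst]
    rfl
  · rw [ProbabilityMeasure.coe_mk, Measure.map_map measurable_snd hst]
    rfl
  · rw [ProbabilityMeasure.coe_mk, integral_map hst.aemeasurable
      (continuous_dStar hα).measurable.aestronglyMeasurable]
    have hpt : ∀ z : X, dStar Δ α ((circleConj σ).symm z) ((circleConj τ).symm z) ≤
        Δ * (2 * (3 / 4) ^ n) ^ α := by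
      intro z
      induction z using QuotientAddGroup.induction_on with | _ y =>
      refine (min_le_right _ _).trans (mul_le_mul_of_nonneg_left
        (Real.rpow_le_rpow dist_nonneg ?_ hα.le) hΔ.le)
      rw [circleConj_symm_coe, circleConj_symm_coe]
      exact (dist_coe_le _ _).trans (abs_conjIso_symm_sub_le h y)
    refine (integral_mono_of_nonneg (Eventually.of_forall fun z => dStar_nonneg α hΔ _ _)
      (integrable_const _) (Eventually.of_forall hpt)).trans ?_
    simp

theorem tendsto_vaserstein_bound (hα : 0 < α) :
    Tendsto (fun n : ℕ => Δ * (2 * (3 / 4 : ℝ) ^ n) ^ α) atTop (𝓝 0) := by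
  have h1 : Tendsto (fun n : ℕ => 2 * (3 / 4 : ℝ) ^ n) atTop (𝓝 0) := by
    simpa using (tendsto_pow_atTop_nhds_zero_of_lt_one (by norm_num : (0 : ℝ) ≤ 3 / 4)
      (by norm_num)).const_mul 2
  have h2 := (h1.rpow_const (p := α) (Or.inr hα.le)).const_mul Δ
  rwa [Real.zero_rpow hα.ne', mul_zero] at h2

theorem vaserstein_wordMeasure_self (hΔ : 0 < Δ) (hα : 0 < α) (σ : LeftWord) :
    vaserstein Δ α (wordMeasure σ) (wordMeasure σ) = 0 :=
  le_antisymm (ge_of_tendsto' (tendsto_vaserstein_bound hα) fun n =>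
    vaserstein_wordMeasure_le hΔ hα (n := n) fun _ _ => rfl) (vaserstein_nonneg hΔ _ _)

theorem exists_equilibriumState_eq (p : G) : ∃ σ, equilibriumState p = wordMeasure σ := by
  obtain ⟨σ, n, rfl, hσ⟩ := exists_eq_truncation p
  exact ⟨σ, equilibriumState_truncation σ n hσ⟩

/-- The word `τ` repeats the truncated word periodically, so it begins like `σ`. -/
theorem exists_equilibriumState_truncation_eq (σ : LeftWord) (n : ℕ) :
    ∃ τ, (∀ k < n, τ k = σ k) ∧ equilibriumState (truncation σ n) = wordMeasure τ := by
  refine ⟨fun k => σ (k % (n + 1)), fun k hk => ?_, ?_⟩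
  · exact congrArg σ (Nat.mod_eq_of_lt (hk.trans n.lt_succ_self))
  · rw [← equilibriumState_truncation _ n fun k => by simp]
    congr 1
    exact truncation_congr fun k hk => by rw [Nat.mod_eq_of_lt (Nat.lt_succ_of_le hk)]

theorem distG_of_ne {p q : G} (h : p ≠ q) :
    distG Δ α p q = vaserstein Δ α (equilibriumState p) (equilibriumState q)
      + invKappa p + invKappa q := if_neg h

theorem distG_self (p : G) : distG Δ α p p = 0 := if_pos rfl

theorem distG_le (hΔ : 0 < Δ) (p q : G) :
    distG Δ α p q ≤ vaserstein Δ α (equilibriumState p) (equilibriumState q)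
      + invKappa p + invKappa q := by
  rcases eq_or_ne p q with rfl | h
  · rw [distG_self]
    have := vaserstein_nonneg (α := α) hΔ (equilibriumState p) (equilibriumState p)
    have := invKappa_pos p
    linarith
  · exact (distG_of_ne h).le

theorem vaserstein_le_distG (hΔ : 0 < Δ) (hα : 0 < α) (p q : G) :
    vaserstein Δ α (equilibriumState p) (equilibriumState q) ≤ distG Δ α p q := by
  rcases eq_or_ne p q with rfl | h
  · obtain ⟨σ, hσ⟩ := exists_equilibriumState_eq p
    rw [distG_self, hσ, vaserstein_wordMeasure_self hΔ hα]
  · rw [distG_of_ne h]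
    have := invKappa_pos p
    have := invKappa_pos q
    linarith

theorem invKappa_le_distG (hΔ : 0 < Δ) {p q : G} (h : p ≠ q) : invKappa p ≤ distG Δ α p q := by
  rw [distG_of_ne h]
  have := vaserstein_nonneg (α := α) hΔ (equilibriumState p) (equilibriumState q)
  have := invKappa_pos q
  linarith

/-- The metric on `𝔾`. -/
@[reducible]
noncomputable def metricG (hΔ : 0 < Δ) (hα : 0 < α) (hα1 : α ≤ 1) : MetricSpace G where
  dist := distG Δ α
  dist_self := distG_self
  dist_comm p q := by
    rcases eq_or_ne p q with rfl | h
    · rfl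
    · rw [distG_of_ne h, distG_of_ne h.symm, vaserstein_comm hΔ hα]
      ring
  dist_triangle p q r := by
    have hpq := invKappa_pos p
    have hq := invKappa_pos q
    have hr := invKappa_pos r
    rcases eq_or_ne p q with rfl | h1
    · rw [distG_self, zero_add]
    rcases eq_or_ne q r with rfl | h2
    · rw [distG_self, add_zero]
    -- `distG_le` includes the case `p = r`; the middle point only contributes the nonnegative
    -- excess `2 * invKappa q`.
    refine (distG_le hΔ p r).trans ?_
    rw [distG_of_ne h1, distG_of_ne h2]
    have := vaserstein_triangle hΔ hα hα1 (equilibriumState p) (equilibriumState q)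
      (equilibriumState r)
    linarith
  eq_of_dist_eq_zero {p q} h := by
    by_contra hne
    have h1 := invKappa_le_distG (α := α) hΔ hne
    have h2 := invKappa_pos p
    change distG Δ α p q = 0 at h
    linarith

/-! ### The boundary -/

theorem tendsto_pow_three_quarters : Tendsto (fun n : ℕ => (3 / 4 : ℝ) ^ n) atTop (𝓝 0) :=
  tendsto_pow_atTop_nhds_zero_of_lt_one (by norm_num) (by norm_num)

theorem pow_three_quarters_anti {k n : ℕ} (h : k ≤ n) : (3 / 4 : ℝ) ^ n ≤ (3 / 4) ^ k :=
  pow_le_pow_of_le_one (by norm_num) (by norm_num) h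

/-- Keeping `p` arbitrary, with its own `invKappa`, allows it to be a term of a sequence approaching
an unknown boundary point. -/
theorem distG_truncation_le_add (hΔ : 0 < Δ) (hα : 0 < α) {p : G} {σ τ : LeftWord}
    (hp : equilibriumState p = wordMeasure τ) {k n : ℕ} (hn : k ≤ n) (h : ∀ j < k, τ j = σ j) :
    distG Δ α p (truncation σ n) ≤
      Δ * (2 * (3 / 4) ^ k) ^ α + (3 / 4) ^ k + invKappa p := by
  obtain ⟨ρ, hρ, he⟩ := exists_equilibriumState_truncation_eq σ n
  have h1 := distG_le (α := α) hΔ p (truncation σ n)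
  rw [hp, he] at h1
  have h2 := vaserstein_wordMeasure_le hΔ hα (σ := τ) (τ := ρ) (n := k) fun j hj =>
    (h j hj).trans (hρ j (hj.trans_le hn)).symm
  have h3 := (invKappa_truncation_le σ n).trans (pow_three_quarters_anti hn)
  linarith

theorem distG_truncation_le (hΔ : 0 < Δ) (hα : 0 < α) {σ τ : LeftWord} {k n m : ℕ} (hn : k ≤ n)
    (hm : k ≤ m) (h : ∀ j < k, σ j = τ j) :
    distG Δ α (truncation σ n) (truncation τ m) ≤
      Δ * (2 * (3 / 4) ^ k) ^ α + 2 * (3 / 4) ^ k := by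
  obtain ⟨ρ, hρ, he⟩ := exists_equilibriumState_truncation_eq σ n
  have h1 := distG_truncation_le_add hΔ hα he hm fun j hj =>
    (hρ j (hj.trans_le hn)).trans (h j hj)
  have h3 := (invKappa_truncation_le σ n).trans (pow_three_quarters_anti hn)
  linarith

theorem tendsto_distG_bound (hα : 0 < α) :
    Tendsto (fun k : ℕ => Δ * (2 * (3 / 4 : ℝ) ^ k) ^ α + 2 * (3 / 4) ^ k) atTop (𝓝 0) := by
  simpa using (tendsto_vaserstein_bound (Δ := Δ) hα).add (tendsto_pow_three_quarters.const_mul 2)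

theorem eventually_agree (σ : LeftWord) (k : ℕ) : ∀ᶠ τ in 𝓝 σ, ∀ j < k, τ j = σ j := by
  have : ∀ᶠ τ in 𝓝 σ, ∀ j ∈ Finset.range k, τ j = σ j :=
    (Filter.eventually_all_finset _).2 fun j _ =>
      (continuous_apply j).continuousAt.eventually (show ∀ᶠ a in 𝓝 (σ j), a = σ j by simp [nhds_discrete])
  simpa using this

open UniformSpace in
theorem exists_metric_boundary_homeomorph (hΔ : 0 < Δ) (hα : 0 < α) (hα1 : α ≤ 1) :
    ∃ _m : MetricSpace G, (∀ p q : G, dist p q = distG Δ α p q) ∧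
      ∃ Φ : LeftWord ≃ₜ Boundary G, ∀ σ : LeftWord,
        Tendsto (fun n : ℕ => (truncation σ n : Completion G)) atTop (𝓝 (Φ σ : Completion G)) := by
  let m : MetricSpace G := metricG hΔ hα hα1
  have hd : ∀ p q : G, dist p q = distG Δ α p q := fun _ _ => rfl
  refine ⟨m, hd, ?_⟩
  set c : ℕ → ℝ := fun k => Δ * (2 * (3 / 4 : ℝ) ^ k) ^ α + 2 * (3 / 4) ^ k with hc
  have hc0 : Tendsto c atTop (𝓝 0) := tendsto_distG_bound hα
  have hcauchy : ∀ σ, CauchySeq (truncation σ) := fun σ =>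
    cauchySeq_of_le_tendsto_0 c
      (fun n m N hn hm => distG_truncation_le hΔ hα hn hm fun _ _ => rfl) hc0
  have hex : ∀ σ, ∃ x : Completion G,
      Tendsto (fun n => (truncation σ n : Completion G)) atTop (𝓝 x) := fun σ =>
    cauchySeq_tendsto_of_complete
      ((Completion.uniformContinuous_coe G).comp_cauchySeq (hcauchy σ))
  choose Φ hΦ using hex
  have hdist : ∀ {σ τ k}, (∀ j < k, σ j = τ j) → dist (Φ σ) (Φ τ) ≤ c k := by
    intro σ τ k h
    refine le_of_tendsto ((hΦ σ).dist (hΦ τ)) ?_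
    filter_upwards [eventually_ge_atTop k] with n hn
    rw [Completion.dist_eq, hd]
    exact distG_truncation_le hΔ hα hn hn h
  have hnot : ∀ σ, Φ σ ∉ range ((↑) : G → Completion G) := by
    rintro σ ⟨p, hp⟩
    have h1 := tendsto_iff_dist_tendsto_zero.1 (hΦ σ)
    have hpos := invKappa_pos p
    obtain ⟨n, hn1, hn2⟩ := ((h1.eventually_lt_const hpos).and
      (tendsto_pow_three_quarters.eventually_lt_const hpos)).exists
    rw [← hp, Completion.dist_eq, dist_comm, hd] at hn1
    -- Elements of `G` are isolated: a truncation nearer to `p` than `invKappa p` would equal `p`,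
    -- but its own `invKappa` is already smaller.
    refine absurd (invKappa_le_distG hΔ ?_) (not_le.2 hn1)
    rintro rfl
    exact absurd (invKappa_truncation_le σ n) (not_le.2 hn2)
  have hinj : Function.Injective Φ := by
    intro σ τ h
    refine wordMeasure_injective (eq_of_vaserstein_eq_zero hΔ hα
      (le_antisymm ?_ (vaserstein_nonneg hΔ _ _)))
    have hlim : Tendsto (fun n => dist (truncation σ n : Completion G) (truncation τ n)) atTop
        (𝓝 0) := by
      have := (hΦ σ).dist (hΦ τ)
      rwa [h, dist_self] at this
    have hb := tendsto_vaserstein_bound (Δ := Δ) hα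
    have hsum := (hb.add hlim).add hb
    rw [add_zero, add_zero] at hsum
    -- The two word measures are compared through the equilibrium states of the `n`-th truncations;
    -- all three terms of the triangle inequality tend to zero.
    refine ge_of_tendsto' hsum fun n => ?_
    obtain ⟨σ', hσ', eσ⟩ := exists_equilibriumState_truncation_eq σ n
    obtain ⟨τ', hτ', eτ⟩ := exists_equilibriumState_truncation_eq τ n
    have t1 := vaserstein_triangle hΔ hα hα1 (wordMeasure σ) (wordMeasure σ') (wordMeasure τ)
    have t2 := vaserstein_triangle hΔ hα hα1 (wordMeasure σ') (wordMeasure τ') (wordMeasure τ)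
    have b1 := vaserstein_wordMeasure_le hΔ hα (σ := σ) (τ := σ') (n := n)
      fun k hk => (hσ' k hk).symm
    have b2 := vaserstein_wordMeasure_le hΔ hα (σ := τ') (τ := τ) (n := n) hτ'
    have b3 := vaserstein_le_distG hΔ hα (truncation σ n) (truncation τ n)
    rw [eσ, eτ] at b3
    rw [Completion.dist_eq, hd]
    linarith
  have hcont : Continuous Φ := by
    rw [continuous_iff_continuousAt]
    intro σ
    rw [ContinuousAt, Metric.tendsto_nhds]
    intro ε hε
    obtain ⟨k, hk⟩ := (hc0.eventually_lt_const hε).exists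
    filter_upwards [eventually_agree σ k] with τ hτ
    exact (hdist hτ).trans_lt hk
  have hsurj : ∀ x : Completion G, x ∉ range ((↑) : G → Completion G) → ∃ σ, Φ σ = x := by
    intro x hx
    have hε : ∀ n : ℕ, (0 : ℝ) < 1 / (n + 1) := fun n => by positivity
    choose p hp using fun n : ℕ => (Completion.denseRange_coe (α := G)).exists_dist_lt x (hε n)
    have hκ : ∀ n, invKappa (p n) ≤ 2 * (1 / (n + 1)) := by
      intro n
      -- As `x` lies outside `G`, some `q` in `G` is nearer to `x` than `p n`. Being distinct, `p n`
      -- and `q` are at least `invKappa (p n)` apart, yet both are within `1 / (n + 1)` of `x`.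
      have hne : 0 < dist x (p n) := dist_pos.2 fun h => hx ⟨_, h.symm⟩
      obtain ⟨q, hq⟩ := (Completion.denseRange_coe (α := G)).exists_dist_lt x hne
      have hpq : p n ≠ q := by
        rintro rfl
        exact lt_irrefl _ hq
      have h1 := invKappa_le_distG (α := α) hΔ hpq
      rw [← hd, ← Completion.dist_eq] at h1
      have h2 := dist_triangle_left (p n : Completion G) q x
      have h3 := hp n
      linarith
    choose w hw using exists_equilibriumState_eq
    -- Compactness of the word space yields the candidate for the preimage of `x`.
    obtain ⟨σ, φ, hφ, hlim⟩ := CompactSpace.tendsto_subseq fun n => w (p n)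
    refine ⟨σ, dist_le_zero.1 (ge_of_tendsto' hc0 fun k => ?_)⟩
    -- Of the factor `3`, two parts bound `invKappa (p (φ n))` and one part the distance from `p (φ
    -- n)` to `x`.
    have h3 : Tendsto (fun n : ℕ => c k + 3 * (1 / ((φ n : ℝ) + 1))) atTop (𝓝 (c k)) := by
      have := ((tendsto_one_div_add_atTop_nhds_zero_nat (𝕜 := ℝ)).comp
        hφ.tendsto_atTop).const_mul 3
      simpa using this.const_add (c k)
    refine ge_of_tendsto h3 ?_
    filter_upwards [hlim.eventually (eventually_agree σ k)] with n hn
    have h4 : dist (p (φ n) : Completion G) (Φ σ) ≤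
        Δ * (2 * (3 / 4) ^ k) ^ α + (3 / 4) ^ k + invKappa (p (φ n)) := by
      refine le_of_tendsto (tendsto_const_nhds.dist (hΦ σ)) ?_
      filter_upwards [eventually_ge_atTop k] with j hj
      rw [Completion.dist_eq, hd]
      exact distG_truncation_le_add hΔ hα (hw _) hj hn
    have h5 := dist_triangle (Φ σ) (p (φ n) : Completion G) x
    have h6 := hp (φ n)
    have h7 := hκ (φ n)
    have h8 : (0 : ℝ) < (3 / 4) ^ k := by positivity
    rw [dist_comm x] at h6
    rw [dist_comm _ (Φ σ)] at h4
    simp only [hc]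
    linarith
  let e : LeftWord ≃ Boundary G := Equiv.ofBijective (fun σ => ⟨Φ σ, hnot σ⟩)
    ⟨fun σ τ h => hinj (congrArg Subtype.val h), fun x => by
      obtain ⟨σ, hσ⟩ := hsurj x.1 x.2
      exact ⟨σ, Subtype.ext hσ⟩⟩
  have he : Continuous e := hcont.subtype_mk _
  -- The inverse is continuous because the word space is compact and the boundary Hausdorff.
  exact ⟨he.homeoOfEquivCompactToT2, hΦ⟩

end Boundary

end EquilibriumBoundary

theorem mainTheorem12 :
    -- the semigroup generated by `T` and `S` is free on these two generators
    (∃ e : FreeSemigroup (Fin 2) ≃* mapSemigroup, ∀ i : Fin 2,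
      ((e (FreeSemigroup.of i) : mapSemigroup) : Function.End X) = gen i) ∧
    -- every element of `𝔾` has exactly one equilibrium state
    (∀ p : G, ∃! μ : ProbabilityMeasure X, IsEquilibriumState p.1.map p.1.potential μ) ∧
    -- `𝔾` is a metric space, and its boundary is homeomorphic to the space of left-infinite words
    (∀ Δ α : ℝ, 0 < Δ → 0 < α → α ≤ 1 →
      ∃ _m : MetricSpace G, (∀ p q : G, dist p q = distG Δ α p q) ∧
        ∃ Φ : LeftWord ≃ₜ Boundary G, ∀ σ : LeftWord,
          Tendsto (fun n : ℕ => (truncation σ n : UniformSpace.Completion G)) atTop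
            (𝓝 (Φ σ : UniformSpace.Completion G))) :=
  ⟨exists_mulEquiv_mapSemigroup, existsUnique_isEquilibriumState,
    fun _ _ hΔ hα hα1 => exists_metric_boundary_homeomorph hΔ hα hα1⟩
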